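/- Let $k\ge 1$ and let $n_1,\dots,n_k$ be nonzero integers such that the pretzel link $K=P(n_1,\dots,n_k)$ is a knot. Let $D$ be its standard diagram: $k$ vertical columns of crossings side by side, the $i$-th column having $|n_i|$ crossings stacked vertically and joined to each other; the upper right (lower right) end of each column is joined to the upper left (lower left) end of the next column, and the ends of the last column are joined to those of the first one by an arc above and an arc below the diagram. At the crossings of the $i$-th column the strand running from south-west to north-east is the overcrossing one if $n_i>0$, and the undercrossing one if $n_i<0$. Orient $D$. Label the $n=|n_1|+\dots+|n_k|$ crossings by $1,\dots,n$, column by column from left to right, downward in the first column and upward in all other columns. Checkerboard colour the faces of $D$ so that the northern and southern corners of every crossing are black and the western and eastern ones white. The overlaid Tait graph is the plane bipartite graph with vertex classes the crossings and the faces of $D$, having one edge for every corner of every crossing, which joins the crossing to the face containing that corner. Its balanced version $\Gamma$ is obtained by deleting two faces: the unbounded (universal) face and the upper deck, i.e. the black face below the upper arc that touches the tops of all columns. Give each edge $\varepsilon$ of $\Gamma$, between a crossing $x$ and a face $f$, the following three weights. * Activity weight $\alpha(\varepsilon)$. It is one of the letters $L,D,\ell,d$ if $x$ lies in a column with $n_i>0$,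 and one of the barred letters $\overline L,\overline D,\overline\ell,\overline d$ if $n_i<0$. The letter is $L$ or $D$ (resp. barred) if $f$ is black and $\ell$ or $d$ if $f$ is white; it is $L$ or $\ell$ if $x$ has the lowest label among all crossings incident with $f$, and $D$ or $d$ otherwise. The letters are evaluated, with $A=t^{-1/4}$, as $$L=-A^{-3},\quad D=A,\quad \ell=-A^{3},\quad d=A^{-1},\quad \overline L=-A^{3},\quad \overline D=A^{-1},\quad \overline\ell=-A^{-3},\quad \overline d=A.$$ * Writhe weight $w(\varepsilon)=(-A)^{-3}$ if $x$ is a positive crossing of the oriented diagram and $(-A)^{3}$ if it is a negative one. * Sign $\kappa(\varepsilon)=-1$ if $\varepsilon$ lies in the corner of $x$ between the two outgoing strands, and $\kappa(\varepsilon)=+1$ otherwise. The signed enhanced activity matrix is the matrix with rows indexed by the crossings and columns indexed by the faces of $D$ other than the two deleted ones, whose entry at $(x,f)$ is the sum of $\kappa(\varepsilon)\,w(\varepsilon)\,\alpha(\varepsilon)$ over the edges $\varepsilon$ of $\Gamma$ between $x$ and $f$ (and $0$ if there are none). Then this matrix is square, of size $n\times n$, and for every ordering of its rows and columns its determinant equals,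 up to sign, the Jones polynomial $$V_K(t)=(-A^{-3})^{w(D)}\langle D\rangle ,\qquad A=t^{-1/4},$$ where $w(D)$ is the writhe of $D$ and $\langle D\rangle$ is its Kauffman bracket, normalized by $\langle \text{unknot without crossings}\rangle=1$, with $\langle D\rangle=A\langle D_0\rangle+A^{-1}\langle D_\infty\rangle$ for the $A$- and $B$-smoothings $D_0,D_\infty$ of a crossing and $\langle U\sqcup D\rangle=(-A^2-A^{-2})\langle D\rangle$ for an additional crossingless circle $U$. -/

import Mathlib

/-! # Link diagrams, Kauffman bracket, Jones polynomial, activity matrix, pretzel diagrams -/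

noncomputable section

/-- Parity of a position around a crossing. -/
def evenPos (p : Fin 4) : Bool := p.val % 2 == 0

/-- A checkerboard-coloured link diagram on an oriented surface, with set of crossings `C`, given
combinatorially.  The four half-edges (darts) at a crossing `x` are `(x, 0), (x, 1), (x, 2), (x, 3)`
in counterclockwise order, and `nbr` pairs the two darts of each edge of the projection graph.
The same pairs also name the corners: the corner `(x, p)` is the sector at `x` between the darts
`(x, p)` and `(x, p + 1)`.  The numbering is chosen so that the corners `0, 2` are black and
`1, 3` are white; this is what `nbr_parity` expresses.  `overEven x` says whether the overcrossing
strand at `x` consists of the darts `0, 2` or of the darts `1, 3`. -/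
structure LinkDiagram (C : Type) where
  nbr : C × Fin 4 → C × Fin 4
  nbr_nbr : ∀ d, nbr (nbr d) = d
  nbr_parity : ∀ d, evenPos (nbr d).2 = !evenPos d.2
  overEven : C → Bool

namespace LinkDiagram

variable {C : Type} (D : LinkDiagram C)

/-! ## Components and orientations -/

/-- Two darts are consecutive on a link component: they form an edge, or they are opposite at a
crossing. -/
def StrandStep (d d' : C × Fin 4) : Prop := d' = D.nbr d ∨ d' = (d.1, d.2 + 2)

/-- The components of the link. -/
def Component : Type := Quot D.StrandStep

/-- The diagram represents a knot. -/
def IsKnot : Prop := Nat.card D.Component = 1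

/-- An orientation of the link: `out d` says that the strand runs along the dart `d` away from
its crossing. -/
structure Orientation where
  out : C × Fin 4 → Bool
  out_nbr : ∀ d, out (D.nbr d) = !out d
  out_opp : ∀ x p, out (x, p + 2) = !out (x, p)

/-- The dart in position `p` at `x` belongs to the overcrossing strand. -/
def IsOver (x : C) (p : Fin 4) : Prop := evenPos p = D.overEven x

variable {D} in
/-- A crossing is positive if the outgoing under-dart follows the outgoing over-dart
counterclockwise. -/
def Orientation.IsPositive (o : D.Orientation) (x : C) : Prop :=
  ∃ p : Fin 4, D.IsOver x p ∧ o.out (x, p) = true ∧ o.out (x, p + 1) = true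

open Classical in
variable {D} in
/-- The contribution `±1` of a crossing to the writhe. -/
def Orientation.sign (o : D.Orientation) (x : C) : ℤ := if o.IsPositive x then 1 else -1

variable {D} in
/-- The writhe of an oriented diagram. -/
def Orientation.writhe [Fintype C] (o : D.Orientation) : ℤ := ∑ x, o.sign x

/-! ## Kauffman bracket and Jones polynomial

The ring `ℤ[t^(1/4), t^(-1/4)]` is `LaurentPolynomial ℤ`, with `T m` standing for `t^(m/4)`. -/

/-- `A = t^(-1/4)`, as a unit. -/
def varA : (LaurentPolynomial ℤ)ˣ where
  val := LaurentPolynomial.T (-1)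
  inv := LaurentPolynomial.T 1
  val_inv := by rw [← LaurentPolynomial.T_add]; simp
  inv_val := by rw [← LaurentPolynomial.T_add]; simp

/-- The dart joined to position `p` by a smoothing of a crossing.  If `b` is true, the smoothing
joins `0` to `1` and `2` to `3` (so it merges the white corners `1`, `3` and separates the black
ones); if `b` is false it joins `1` to `2` and `3` to `0`. -/
def smoothPos (b : Bool) (p : Fin 4) : Fin 4 := if evenPos p = b then p + 1 else p - 1

/-- The smoothing of the crossing `x`: the `A`-smoothing for `a = true`, the `B`-smoothing for
`a = false`.  The `A`-smoothing merges the two corners that the overcrossing strand sweeps when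
it is turned counterclockwise: these are `0, 2` if the darts `0, 2` are over, else `1, 3`. -/
def smooth (x : C) (a : Bool) (p : Fin 4) : Fin 4 := smoothPos (xor a (D.overEven x)) p

/-- Consecutive darts on a loop of the smoothed diagram of the state `s`
(`s x = true` for an `A`-smoothing at `x`). -/
def LoopStep (s : C → Bool) (d d' : C × Fin 4) : Prop :=
  d' = D.nbr d ∨ d' = (d.1, D.smooth d.1 (s d.1) d.2)

/-- The number of loops of a state. -/
def loops (s : C → Bool) : ℕ := Nat.card (Quot (D.LoopStep s))

/-- The Kauffman bracket, normalized to be `1` on the unknot diagram without crossings. -/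
def bracket [Fintype C] [DecidableEq C] : LaurentPolynomial ℤ :=
  ∑ s : C → Bool, ((∏ x, if s x then varA else varA⁻¹ : (LaurentPolynomial ℤ)ˣ) :
      LaurentPolynomial ℤ) *
    (-((varA ^ (2 : ℤ) : (LaurentPolynomial ℤ)ˣ) : LaurentPolynomial ℤ)
      - ((varA ^ (-2 : ℤ) : (LaurentPolynomial ℤ)ˣ) : LaurentPolynomial ℤ)) ^ (D.loops s - 1)

variable {D} in
/-- The Jones polynomial `(-A⁻³)^w ⟨D⟩` with `A = t^(-1/4)`. -/
def Orientation.jones [Fintype C] [DecidableEq C] (o : D.Orientation) : LaurentPolynomial ℤ :=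
  (((-(varA ^ (-3 : ℤ))) ^ o.writhe : (LaurentPolynomial ℤ)ˣ) : LaurentPolynomial ℤ) * D.bracket

/-! ## Faces of the projection graph -/

/-- The next corner of the same face, running along the edge of the dart `(x, p)`. -/
def nextCorner (c : C × Fin 4) : C × Fin 4 := ((D.nbr c).1, (D.nbr c).2 - 1)

/-- The faces of the projection graph. -/
def Face : Type := Quot fun c c' : C × Fin 4 => c' = D.nextCorner c

/-- The face in which a corner lies. -/
def face (c : C × Fin 4) : D.Face := Quot.mk _ c

/-- The checkerboard colour of a face. -/
def Face.black {D : LinkDiagram C} : D.Face → Bool :=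
  Quot.lift (fun c => evenPos c.2) (by
    rintro c c' rfl
    have h := D.nbr_parity c
    revert h
    simp only [nextCorner]
    generalize (D.nbr c).2 = q
    generalize c.2 = p
    revert p q
    decide)

/-! ## The activity matrix

The overlaid Tait graph has an edge for every corner `(x, p)`; it joins the crossing `x` to the
face of that corner.  The vertices of the Tait graph are the black faces, those of its dual are
the white faces. -/

/-- Tutte's activity letters. -/
inductive ActivityLetter
  | L | D | l | d | Lbar | Dbar | lbar | dbar

/-- Evaluation of the activity letters for the Jones polynomial. -/
def ActivityLetter.eval : ActivityLetter → (LaurentPolynomial ℤ)ˣ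
  | .L => -(varA ^ (-3 : ℤ))
  | .D => varA
  | .l => -(varA ^ (3 : ℤ))
  | .d => varA ^ (-1 : ℤ)
  | .Lbar => -(varA ^ (3 : ℤ))
  | .Dbar => varA ^ (-1 : ℤ)
  | .lbar => -(varA ^ (-3 : ℤ))
  | .dbar => varA

/-- Sign of a crossing as an edge of the Tait graph: positive if turning the overcrossing strand
counterclockwise sweeps the black corners. -/
def taitPositive (x : C) : Bool := D.overEven x

/-- An edge of the overlaid Tait graph is live if its crossing has the lowest label among all
crossings incident with its face. -/
def IsLive (label : C → ℕ) (c : C × Fin 4) : Prop :=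
  ∀ c' : C × Fin 4, D.face c' = D.face c → label c.1 ≤ label c'.1

open Classical in
/-- The activity weighting of an edge of the overlaid Tait graph. -/
def activity (label : C → ℕ) (c : C × Fin 4) : ActivityLetter :=
  match D.taitPositive c.1, (D.face c).black, decide (D.IsLive label c) with
  | true, true, true => .L
  | true, true, false => .D
  | true, false, true => .l
  | true, false, false => .d
  | false, true, true => .Lbar
  | false, true, false => .Dbar
  | false, false, true => .lbar
  | false, false, false => .dbar

open Classical in
variable {D} in
/-- The writhe weighting of the edges at a crossing. -/
def Orientation.writheWeight (o : D.Orientation) (x : C) : (LaurentPolynomial ℤ)ˣ :=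
  if o.IsPositive x then (-varA) ^ (-3 : ℤ) else (-varA) ^ (3 : ℤ)

variable {D} in
/-- Kauffman's trick: an edge is negative if it lies in the corner between the two outgoing
darts. -/
def Orientation.kappa (o : D.Orientation) (c : C × Fin 4) : (LaurentPolynomial ℤ)ˣ :=
  if o.out c = true ∧ o.out (c.1, c.2 + 1) = true then -1 else 1

open Classical in
variable {D} in
/-- The signed enhanced activity matrix: the weighted bipartite adjacency matrix (crossings versus
faces) of the balanced overlaid Tait graph obtained by omitting the faces `f₁` and `f₂`. -/
def Orientation.activityMatrix (o : D.Orientation) (label : C → ℕ) (f₁ f₂ : D.Face) :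
    Matrix C {f : D.Face // f ≠ f₁ ∧ f ≠ f₂} (LaurentPolynomial ℤ) :=
  fun x f => ∑ p : Fin 4, if D.face (x, p) = f.1 then
    ((o.kappa (x, p) * o.writheWeight x * (D.activity label (x, p)).eval :
      (LaurentPolynomial ℤ)ˣ) : LaurentPolynomial ℤ) else 0

end LinkDiagram

/-! ## Pretzel diagrams -/

/-- The crossings of the standard diagram of `P(n_1, …, n_k)`: `⟨i, j⟩` is the crossing number `j`
from the top, starting with `0`, in the `i`-th column from the left. -/
abbrev PretzelCrossing {k : ℕ} (n : Fin k → ℤ) : Type := Σ i : Fin k, Fin (n i).natAbs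

section
variable {k : ℕ} (n : Fin k → ℤ) (hn : ∀ i, n i ≠ 0)

/-- The top crossing of a column. -/
def pretzelTop (i : Fin k) : PretzelCrossing n := ⟨i, 0, Int.natAbs_pos.2 (hn i)⟩

/-- The bottom crossing of a column. -/
def pretzelBottom (i : Fin k) : PretzelCrossing n :=
  ⟨i, (n i).natAbs - 1, Nat.sub_lt (Int.natAbs_pos.2 (hn i)) one_pos⟩

/-- The edges of the pretzel diagram.  The darts `0, 1, 2, 3` point north-east, north-west,
south-west and south-east.  Columns are numbered cyclically. -/
def pretzelNbr [NeZero k] : PretzelCrossing n × Fin 4 → PretzelCrossing n × Fin 4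
  | (⟨i, j⟩, 0) => if j.1 = 0 then (pretzelTop n hn (i + 1), 1)
      else (⟨i, j.1 - 1, by omega⟩, 3)
  | (⟨i, j⟩, 1) => if j.1 = 0 then (pretzelTop n hn (i - 1), 0)
      else (⟨i, j.1 - 1, by omega⟩, 2)
  | (⟨i, j⟩, 2) => if h : j.1 + 1 < (n i).natAbs then (⟨i, j.1 + 1, h⟩, 1)
      else (pretzelBottom n hn (i - 1), 3)
  | (⟨i, j⟩, 3) => if h : j.1 + 1 < (n i).natAbs then (⟨i, j.1 + 1, h⟩, 0)
      else (pretzelBottom n hn (i + 1), 2)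

/-- The standard diagram of `P(n_1, …, n_k)`: the strand from south-west to north-east is over in
the columns with `n_i > 0`, the other strand in the columns with `n_i < 0`.  The corners
`0, 1, 2, 3` of a crossing are north, west, south and east; north and south are black. -/
def pretzelDiagram [NeZero k] : LinkDiagram (PretzelCrossing n) where
  nbr := pretzelNbr n hn
  nbr_nbr := by
    rintro ⟨⟨i, j, hj⟩, p⟩
    match p with
    | 0 =>
      by_cases h : j = 0
      · subst h
        simp only [pretzelNbr, pretzelTop, if_true]
        exact congrArg (fun i => (pretzelTop n hn i, (0 : Fin 4))) (add_sub_cancel_right i 1)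
      · have h' : j - 1 + 1 = j := by omega
        simp [pretzelNbr, h, h', hj]
    | 1 =>
      by_cases h : j = 0
      · subst h
        simp only [pretzelNbr, pretzelTop, if_true]
        exact congrArg (fun i => (pretzelTop n hn i, (1 : Fin 4))) (sub_add_cancel i 1)
      · have h' : j - 1 + 1 = j := by omega
        simp [pretzelNbr, h, h', hj]
    | 2 =>
      by_cases h : j + 1 < (n i).natAbs
      · simp [pretzelNbr, h]
      · obtain rfl : j = (n i).natAbs - 1 := by omega
        have h1 := Int.natAbs_pos.2 (hn (i - 1))
        have h2 : ¬ (n (i - 1)).natAbs - 1 + 1 < (n (i - 1)).natAbs := by omega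
        simp only [pretzelNbr, h, pretzelBottom, h2, dite_false]
        exact congrArg (fun i => (pretzelBottom n hn i, (2 : Fin 4))) (sub_add_cancel i 1)
    | 3 =>
      by_cases h : j + 1 < (n i).natAbs
      · simp [pretzelNbr, h]
      · obtain rfl : j = (n i).natAbs - 1 := by omega
        have h1 := Int.natAbs_pos.2 (hn (i + 1))
        have h2 : ¬ (n (i + 1)).natAbs - 1 + 1 < (n (i + 1)).natAbs := by omega
        simp only [pretzelNbr, h, pretzelBottom, h2, dite_false]
        exact congrArg (fun i => (pretzelBottom n hn i, (3 : Fin 4))) (add_sub_cancel_right i 1)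
  nbr_parity := by
    rintro ⟨⟨i, j, hj⟩, p⟩
    match p with
    | 0 | 1 | 2 | 3 =>
      simp only [pretzelNbr]
      split_ifs <;> simp [evenPos]
  overEven := fun x => decide (0 < n x.1)

/-- The labels `1, …, n` of the crossings: column by column from left to right, downward in the
first column and upward in the others. -/
def pretzelLabel [NeZero k] (x : PretzelCrossing n) : ℕ :=
  (∑ i ∈ Finset.univ.filter (· < x.1), (n i).natAbs) +
    if x.1 = 0 then x.2.1 + 1 else (n x.1).natAbs - x.2.1

/-- The upper deck supported by the columns: the face north of the first column. -/
def upperDeck [NeZero k] : (pretzelDiagram n hn).Face :=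
  (pretzelDiagram n hn).face (pretzelTop n hn 0, 0)

/-- The universal (unbounded) face: the face west of the first column. -/
def universalFace [NeZero k] : (pretzelDiagram n hn).Face :=
  (pretzelDiagram n hn).face (pretzelTop n hn 0, 1)

end

end

/-! # The signed enhanced activity matrix of a pretzel knot computes its Jones polynomial -/

set_option linter.unusedSectionVars false

noncomputable section

/-! The determinant and the Kauffman bracket are computed separately and meet in one formula. Write
`δ` for the loop value, `v` for `A` or `A⁻¹` according to the sign of the column (`colV`), and `Y i`
for the weighted sum over the smoothings of column `i` in which at least one crossing separates its
black corners (is cut), with `δ` to the number of cuts minus one. After multiplication by `δ`, both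
sides equal `∏ (Y i + δ v_i^|n_i|) + (δ² - 1) ∏ Y i`.

Bracket: a column with `c > 0` cuts traps `c - 1` loops. The remaining loops number two if every
column is cut, and otherwise as many as there are uncut columns (`loops_of_forall_cut`,
`loops_of_exists_uncut`). Hence `δ ^ loops` is a sum of two products over the columns (`pow_loops`),
and the state sum factors (`mul_bracket`). The binomial theorem gives `δ * Y i = (-v_i⁻³)^|n_i| -
v_i^|n_i|` (`mul_cutSum`).

Signs: around each edge of the diagram the four adjacent corner signs multiply to `-1`, a Kasteleyn
condition. The pattern with north and east negative satisfies it too, so the two patterns differ by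
signs of rows and columns only (`cornerSign_eq_gauge`). The writhe weights factor out of the rows as
`(-A⁻³)^w`, and `standardMatrix` remains, free of the orientation.

Determinant: within a column of crossings the black faces between neighbours give a bidiagonal
block. Eliminating all blocks leaves one row per column of crossings and one column for the south
face and each bounded white face (`det_eq_det_of_bidiagonal_blocks`). The sums produced by the
elimination are geometric and equal to the same `Y i`. The reduced matrix is bordered bidiagonal,
and its determinant telescopes to the formula above (`mul_borderedBidiagonal_det_of_first`). -/

/-- A matrix whose nonzero off-diagonal entries strictly decrease a rank function has the product
of its diagonal entries as determinant. -/
theorem Matrix.det_eq_prod_diag_of_rank {m R : Type*} [Fintype m] [DecidableEq m] [CommRing R]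
    (M : Matrix m m R) (rank : m → ℕ)
    (h : ∀ x y, x ≠ y → M x y ≠ 0 → rank y < rank x) : M.det = ∏ x, M x x := by
  rw [Matrix.det_apply', Finset.sum_eq_single 1]
  · simp
  · intro σ _ hσ
    -- Otherwise `σ` would weakly raise the rank everywhere and strictly at every moved point,
    -- although it preserves the sum of all ranks.
    have : ∃ x, M (σ x) x = 0 := by
      by_contra! hne
      have hle : ∀ x, rank x ≤ rank (σ x) := fun x => by
        by_cases hx : σ x = x
        · rw [hx]
        · exact (h _ _ hx (hne x)).le
      obtain ⟨x, hx⟩ : ∃ x, σ x ≠ x := by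
        by_contra! hx
        exact hσ (Equiv.ext hx)
      have hlt : ∑ x, rank x < ∑ x, rank (σ x) :=
        Finset.sum_lt_sum (fun x _ => hle x) ⟨x, Finset.mem_univ _, h _ _ hx (hne x)⟩
      exact hlt.ne (Equiv.sum_comp σ rank).symm
    obtain ⟨x, hx⟩ := this
    exact mul_eq_zero_of_right _ (Finset.prod_eq_zero (Finset.mem_univ x) hx)
  · simp

/-! ### Bordered bidiagonal determinants -/

/-- A bordered bidiagonal matrix. -/
def borderedBidiagonal {R : Type*} [CommRing R] {k : ℕ} [NeZero k] (β Y Z : Fin k → R) :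
    Matrix (Fin k) (Fin k) R := Matrix.of fun i j =>
  if j = 0 then β i else if j = i then Y i else if j = i + 1 then - Z i else 0

theorem det_upper_bidiagonal {R : Type*} [CommRing R] {k : ℕ} (Y W : Fin k → R) :
    Matrix.det (Matrix.of fun i j : Fin k =>
      if j = i then Y i else if j.val = i.val + 1 then W i else 0) =
      ∏ i, Y i := by
  rw [Matrix.det_of_isUpperTriangular]
  · simp
  · intro i j hij
    have h1 : j ≠ i := ne_of_lt hij
    have h2 : j.val ≠ i.val + 1 := by
      have : j.val < i.val := hij
      omega
    simp [h1, h2]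

/-- Laplace expansion along row 0, which is supported in columns 0 and 1. Deleting column 0 leaves
an upper bidiagonal matrix, deleting column 1 a matrix of the same shape; the cofactor sign cancels
the sign of `-Z 0`. -/
theorem borderedBidiagonal_det_succ {R : Type*} [CommRing R] {k : ℕ}
    (β Y Z : Fin (k + 2) → R) :
    (borderedBidiagonal β Y Z).det = β 0 * ∏ i : Fin (k + 1), Y i.succ +
      Z 0 * (borderedBidiagonal (fun i : Fin (k + 1) => β i.succ) (fun i => Y i.succ)
        (fun i => Z i.succ)).det := by
  -- A wrap-around of the cyclic successor lands on 0, never on `j.succ`, so cyclic and linear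
  -- adjacency agree here.
  have key : ∀ i j : Fin (k + 1), i.succ + 1 = j.succ ↔ j.val = i.val + 1 := by
    intro i j
    rw [Fin.ext_iff, Fin.val_add_one]
    split_ifs with h
    · have := congrArg Fin.val h
      simp at this ⊢
      omega
    · simp
      omega
  rw [Matrix.det_succ_row_zero, Fin.sum_univ_succ, Fin.sum_univ_succ, Finset.sum_eq_zero]
  · have e1 : (borderedBidiagonal β Y Z).submatrix Fin.succ (Fin.succAbove 0) =
        Matrix.of fun i j : Fin (k + 1) => if j = i then Y i.succ else
          if j.val = i.val + 1 then - Z i.succ else 0 := by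
      ext i j
      simp only [borderedBidiagonal, Matrix.of_apply, Matrix.submatrix_apply,
        Fin.zero_succAbove, Fin.succ_ne_zero,
        if_false, Fin.succ_inj, eq_comm (a := j.succ) (b := i.succ + 1), key]
    have e2 : (borderedBidiagonal β Y Z).submatrix Fin.succ (Fin.succAbove (Fin.succ 0)) =
        borderedBidiagonal (fun i : Fin (k + 1) => β i.succ) (fun i => Y i.succ)
          (fun i => Z i.succ) := by
      ext i j
      refine Fin.cases ?_ (fun j => ?_) j
      · simp [borderedBidiagonal]
      · have e3 : (Fin.succ (0 : Fin (k + 1))).succAbove j.succ = j.succ.succ := by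
          rw [Fin.succ_succAbove_succ, Fin.zero_succAbove]
        have e4 : (j.succ = i + 1) ↔ (j.succ.succ = i.succ + 1) := by
          rw [eq_comm (a := j.succ.succ), key, Fin.ext_iff, Fin.val_add_one]
          split_ifs with h
          · have := congrArg Fin.val h
            simp at this ⊢
            omega
          · simp
        simp only [borderedBidiagonal, Matrix.of_apply, Matrix.submatrix_apply, e3,
          Fin.succ_ne_zero, if_false,
          Fin.succ_inj, e4]
    rw [e1, e2, det_upper_bidiagonal]
    simp [borderedBidiagonal]
  · intro j _
    have : ¬ j.succ.succ = (1 : Fin (k + 2)) := by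
      rw [Fin.ext_iff]; simp
    simp [borderedBidiagonal, this, Fin.succ_ne_zero]

theorem borderedBidiagonal_det_one {R : Type*} [CommRing R] (β Y Z : Fin 1 → R) :
    (borderedBidiagonal β Y Z).det = β 0 := by
  simp [borderedBidiagonal]

/-- Since `δ * X i = Z i - Y i`, expanding the determinant yields the telescoping sum of `Z 0 ⋯ Z
(i-1) (Z i - Y i) Y (i+1) ⋯`. -/
theorem mul_borderedBidiagonal_det {R : Type*} [CommRing R] (δ : R) {k : ℕ}
    (X Y Z : Fin (k + 1) → R) (hZ : ∀ i, Z i = Y i + δ * X i) :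
    δ * (borderedBidiagonal X Y Z).det = ∏ i, Z i - ∏ i, Y i := by
  induction k with
  | zero =>
    rw [borderedBidiagonal_det_one]
    simp [hZ]
  | succ k ih =>
    rw [borderedBidiagonal_det_succ, Fin.prod_univ_succ Z, Fin.prod_univ_succ Y]
    have := ih (fun i => X i.succ) (fun i => Y i.succ) (fun i => Z i.succ) (fun i => hZ _)
    linear_combination Z 0 * this - (∏ i : Fin (k + 1), Y i.succ) * hZ 0

/-- The determinant of the bordered bidiagonal matrix in the situation of a sum over the spanning
trees of a generalized theta graph. -/
theorem mul_borderedBidiagonal_det_of_first {R : Type*} [CommRing R] (δ : R) {k : ℕ} [NeZero k]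
    (β X Y Z : Fin k → R) (hZ : ∀ i, Z i = Y i + δ * X i) (hβ₀ : β 0 = X 0 + δ * Y 0)
    (hβ : ∀ i, i ≠ 0 → β i = X i) :
    δ * (borderedBidiagonal β Y Z).det = ∏ i, Z i + (δ ^ 2 - 1) * ∏ i, Y i := by
  obtain ⟨k, rfl⟩ := Nat.exists_eq_succ_of_ne_zero (NeZero.ne k)
  cases k with
  | zero =>
    have h : (borderedBidiagonal β Y Z).det = β 0 := borderedBidiagonal_det_one β Y Z
    have hp : ∀ f : Fin (Nat.succ 0) → R, ∏ i, f i = f 0 := fun f => Fin.prod_univ_one f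
    rw [hp, hp, h, hZ, hβ₀]
    ring
  | succ k =>
    have e : (fun i : Fin (k + 1) => β i.succ) = fun i => X i.succ :=
      funext fun i => hβ _ (Fin.succ_ne_zero i)
    have := mul_borderedBidiagonal_det δ (fun i : Fin (k + 1) => X i.succ) (fun i => Y i.succ)
      (fun i => Z i.succ) (fun i => hZ _)
    rw [borderedBidiagonal_det_succ, e, Fin.prod_univ_succ Z, Fin.prod_univ_succ Y]
    -- The extra summand `δ * Y 0` of the corner entry has as cofactor the product of the other `Y
    -- i`, which accounts for `δ² ∏ Y i`.
    linear_combination Z 0 * this + (δ * ∏ i : Fin (k + 1), Y i.succ) * hβ₀ -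
      (∏ i : Fin (k + 1), Y i.succ) * hZ 0

/-- Induction along the cyclic order of `Fin k`. -/
theorem Fin.cyclic_induction {k : ℕ} [NeZero k] {P : Fin k → Prop} (h0 : P 0)
    (hs : ∀ i, P i → P (i + 1)) (i : Fin k) : P i := by
  have : ∀ m : ℕ, P (Fin.ofNat k m) := by
    intro m
    induction m with
    | zero => simpa using h0
    | succ m ih =>
      have := hs _ ih
      convert this using 1
      ext
      simp [Fin.val_add]
  have h := this i.val
  rwa [show Fin.ofNat k i.val = i by ext; simp] at h

section
variable {k : ℕ} [NeZero k] (n : Fin k → ℤ) (hn : ∀ i, n i ≠ 0)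

/-! ## Edges and faces of the pretzel diagram -/

theorem pretzel_nbr_top (i : Fin k) :
    (pretzelDiagram n hn).nbr (pretzelTop n hn i, 0) = (pretzelTop n hn (i + 1), 1) := by
  simp [pretzelDiagram, pretzelNbr, pretzelTop]

theorem pretzel_nbr_bottom (i : Fin k) :
    (pretzelDiagram n hn).nbr (pretzelBottom n hn i, 3) = (pretzelBottom n hn (i + 1), 2) := by
  have h1 := Int.natAbs_pos.2 (hn i)
  have h2 : ¬ (n i).natAbs - 1 + 1 < (n i).natAbs := by omega
  simp only [pretzelDiagram, pretzelNbr, pretzelBottom, h2, dite_false]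

theorem pretzel_nbr_left (i : Fin k) (j : ℕ) (h : j + 1 < (n i).natAbs) :
    (pretzelDiagram n hn).nbr (⟨i, j, by omega⟩, 2) = (⟨i, j + 1, h⟩, 1) := by
  simp [pretzelDiagram, pretzelNbr, h]

theorem pretzel_nbr_right (i : Fin k) (j : ℕ) (h : j + 1 < (n i).natAbs) :
    (pretzelDiagram n hn).nbr (⟨i, j, by omega⟩, 3) = (⟨i, j + 1, h⟩, 0) := by
  simp [pretzelDiagram, pretzelNbr, h]

theorem pretzelBottom_of_not_lt (i : Fin k) (j : Fin (n i).natAbs)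
    (h : ¬ j.1 + 1 < (n i).natAbs) : (⟨i, j⟩ : PretzelCrossing n) = pretzelBottom n hn i := by
  have := j.2
  have e : j = ⟨(n i).natAbs - 1, by omega⟩ := Fin.ext (by simp only; omega)
  rw [e]
  rfl

theorem pretzelTop_of_eq_zero (i : Fin k) (j : Fin (n i).natAbs)
    (h : j.1 = 0) : (⟨i, j⟩ : PretzelCrossing n) = pretzelTop n hn i := by
  have e : j = ⟨0, Int.natAbs_pos.2 (hn i)⟩ := Fin.ext h
  rw [e]
  rfl

/-- A symmetric relation holds between the two ends of every edge of the pretzel diagram if it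
holds for the four kinds of edges. -/
theorem pretzel_edge_cases {P : PretzelCrossing n × Fin 4 → PretzelCrossing n × Fin 4 → Prop}
    (symm : ∀ d d', P d d' → P d' d)
    (top : ∀ i, P (pretzelTop n hn i, 0) (pretzelTop n hn (i + 1), 1))
    (bottom : ∀ i, P (pretzelBottom n hn i, 3) (pretzelBottom n hn (i + 1), 2))
    (left : ∀ i j, ∀ h : j + 1 < (n i).natAbs, P (⟨i, j, by omega⟩, 2) (⟨i, j + 1, h⟩, 1))
    (right : ∀ i j, ∀ h : j + 1 < (n i).natAbs, P (⟨i, j, by omega⟩, 3) (⟨i, j + 1, h⟩, 0))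
    (d : PretzelCrossing n × Fin 4) : P d ((pretzelDiagram n hn).nbr d) := by
  have key : ∀ d d', (pretzelDiagram n hn).nbr d' = d → P d' d →
      P d ((pretzelDiagram n hn).nbr d) := by
    rintro d d' rfl h
    rw [(pretzelDiagram n hn).nbr_nbr]
    exact symm _ _ h
  obtain ⟨⟨i, j⟩, p⟩ := d
  match p with
  | 0 =>
    by_cases h : j.1 = 0
    · rw [pretzelTop_of_eq_zero n hn i j h, pretzel_nbr_top]
      exact top i
    · obtain ⟨_ | j, hj⟩ := j
      · exact absurd rfl h
      · exact key _ _ (pretzel_nbr_right n hn i j hj) (right i j hj)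
  | 1 =>
    by_cases h : j.1 = 0
    · rw [pretzelTop_of_eq_zero n hn i j h]
      have h1 := pretzel_nbr_top n hn (i - 1)
      have h2 := top (i - 1)
      rw [sub_add_cancel] at h1 h2
      exact key _ _ h1 h2
    · obtain ⟨_ | j, hj⟩ := j
      · exact absurd rfl h
      · exact key _ _ (pretzel_nbr_left n hn i j hj) (left i j hj)
  | 2 =>
    by_cases h : j.1 + 1 < (n i).natAbs
    · have := left i j h
      rwa [← pretzel_nbr_left n hn i j h] at this
    · rw [pretzelBottom_of_not_lt n hn i j h]
      have h1 := pretzel_nbr_bottom n hn (i - 1)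
      have h2 := bottom (i - 1)
      rw [sub_add_cancel] at h1 h2
      exact key _ _ h1 h2
  | 3 =>
    by_cases h : j.1 + 1 < (n i).natAbs
    · have := right i j h
      rwa [← pretzel_nbr_right n hn i j h] at this
    · rw [pretzelBottom_of_not_lt n hn i j h, pretzel_nbr_bottom]
      exact bottom i

/-- A code for the face of a corner: `inl true` is the upper deck, `inl false` the universal face,
and the other faces are named by crossings. -/
def faceCode : PretzelCrossing n × Fin 4 → Bool ⊕ PretzelCrossing n
  | (⟨i, j⟩, 0) => if j.1 = 0 then .inl true else .inr ⟨i, j.1 - 1, by omega⟩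
  | (⟨i, _⟩, 1) => if i = 0 then .inl false else .inr (pretzelBottom n hn i)
  | (⟨i, j⟩, 2) => if j.1 + 1 < (n i).natAbs then .inr ⟨i, j⟩ else .inr (pretzelBottom n hn 0)
  | (⟨i, _⟩, 3) => if i + 1 = 0 then .inl false else .inr (pretzelBottom n hn (i + 1))

/-- A corner of the face with a given code. -/
def codeCorner : Bool ⊕ PretzelCrossing n → PretzelCrossing n × Fin 4
  | .inl true => (pretzelTop n hn 0, 0)
  | .inl false => (pretzelTop n hn 0, 1)
  | .inr ⟨i, j⟩ => (⟨i, j⟩, if j.1 + 1 < (n i).natAbs ∨ i = 0 then 2 else 1)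

theorem natAbs_sub_one_add_one_not_lt (i : Fin k) :
    ¬ (n i).natAbs - 1 + 1 < (n i).natAbs := by
  omega

/-- The naming of faces: a crossing that is not at the bottom names the black face directly below
it, the bottom of the first column names the south face, and the bottom of any other column names
the white face west of that column. -/
theorem faceCode_codeCorner (f : Bool ⊕ PretzelCrossing n) :
    faceCode n hn (codeCorner n hn f) = f := by
  match f with
  | .inl true => simp [codeCorner, faceCode, pretzelTop]
  | .inl false => simp [codeCorner, faceCode, pretzelTop]
  | .inr ⟨i, j⟩ =>
    by_cases h : j.1 + 1 < (n i).natAbs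
    · simp [codeCorner, faceCode, h]
    · by_cases hi : i = 0
      · subst hi
        simp only [codeCorner, h, or_true, if_true, faceCode, if_false]
        rw [pretzelBottom_of_not_lt n hn 0 j h]
      · simp only [codeCorner, h, hi, or_self, if_false, faceCode]
        rw [pretzelBottom_of_not_lt n hn i j h]

/-- Invariance along `nextCorner` makes the code descend to faces. The second half is the first half
for the reversed edge; it is included to make the relation symmetric, as `pretzel_edge_cases`
requires. -/
theorem faceCode_edge (d : PretzelCrossing n × Fin 4) :
    faceCode n hn d = faceCode n hn ((pretzelDiagram n hn).nextCorner d) ∧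
      faceCode n hn ((pretzelDiagram n hn).nbr d) = faceCode n hn (d.1, d.2 - 1) := by
  refine pretzel_edge_cases n hn
    (P := fun d d' => faceCode n hn d = faceCode n hn (d'.1, d'.2 - 1) ∧
      faceCode n hn d' = faceCode n hn (d.1, d.2 - 1)) (fun _ _ h => ⟨h.2, h.1⟩) ?_ ?_ ?_ ?_ d
  · intro i
    exact ⟨rfl, rfl⟩
  · intro i
    have h0 := Int.natAbs_pos.2 (hn i)
    have h1 := natAbs_sub_one_add_one_not_lt n i
    have h2 := natAbs_sub_one_add_one_not_lt n (i + 1)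
    constructor
    · rfl
    · simp [faceCode, pretzelBottom, h1, h2, show (3 : Fin 4) - 1 = 2 from rfl]
  · intro i j h
    constructor
    · simp [faceCode, h]
    · rfl
  · intro i j h
    refine ⟨rfl, ?_⟩
    simp [faceCode, h, show (3 : Fin 4) - 1 = 2 from rfl]

theorem pretzel_face_edge {x y : PretzelCrossing n} {p q : Fin 4}
    (h : (pretzelDiagram n hn).nbr (x, p) = (y, q)) :
    (pretzelDiagram n hn).face (x, p) = (pretzelDiagram n hn).face (y, q - 1) ∧
    (pretzelDiagram n hn).face (y, q) = (pretzelDiagram n hn).face (x, p - 1) := by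
  constructor
  · refine Quot.sound ?_
    simp only [LinkDiagram.nextCorner, h]
  · refine Quot.sound ?_
    simp only [LinkDiagram.nextCorner, ← h, LinkDiagram.nbr_nbr]

theorem face_north_top (i : Fin k) : (pretzelDiagram n hn).face (pretzelTop n hn i, 0) =
    (pretzelDiagram n hn).face (pretzelTop n hn 0, 0) := by
  induction i using Fin.cyclic_induction with
  | h0 => rfl
  | hs i ih => exact (pretzel_face_edge n hn (pretzel_nbr_top n hn i)).1.symm.trans ih

theorem face_south_bottom (i : Fin k) : (pretzelDiagram n hn).face (pretzelBottom n hn i, 2) =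
    (pretzelDiagram n hn).face (pretzelBottom n hn 0, 2) := by
  induction i using Fin.cyclic_induction with
  | h0 => rfl
  | hs i ih => exact (pretzel_face_edge n hn (pretzel_nbr_bottom n hn i)).2.trans ih

theorem face_west (i : Fin k) (j : ℕ) (hj : j < (n i).natAbs) :
    (pretzelDiagram n hn).face (⟨i, j, hj⟩, 1) =
      (pretzelDiagram n hn).face (pretzelTop n hn i, 1) := by
  induction j with
  | zero => rfl
  | succ j ih =>
    exact (pretzel_face_edge n hn (pretzel_nbr_left n hn i j hj)).2.trans (ih _)

theorem face_east (i : Fin k) (j : ℕ) (hj : j < (n i).natAbs) :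
    (pretzelDiagram n hn).face (⟨i, j, hj⟩, 3) =
      (pretzelDiagram n hn).face (pretzelTop n hn (i + 1), 1) := by
  have h0 := (pretzel_face_edge n hn (pretzel_nbr_top n hn i)).2
  induction j with
  | zero => exact h0.symm
  | succ j ih =>
    exact (pretzel_face_edge n hn (pretzel_nbr_right n hn i j hj)).1.symm.trans (ih (by omega))

/-- Each corner slides to the chosen corner of its face: around the top or bottom edges for the two
large black faces, along a column for the white ones, across one edge for an inner black face. -/
theorem face_codeCorner_faceCode (c : PretzelCrossing n × Fin 4) :
    (pretzelDiagram n hn).face (codeCorner n hn (faceCode n hn c)) =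
      (pretzelDiagram n hn).face c := by
  have hb : ∀ i, (pretzelDiagram n hn).face (codeCorner n hn (.inr (pretzelBottom n hn i))) =
      (pretzelDiagram n hn).face (pretzelBottom n hn i, if i = 0 then 2 else 1) := by
    intro i
    simp only [codeCorner, pretzelBottom, natAbs_sub_one_add_one_not_lt, false_or]
  obtain ⟨⟨i, j⟩, p⟩ := c
  match p with
  | 0 =>
    by_cases h : j.1 = 0
    · simp only [faceCode, h, if_true, codeCorner]
      rw [pretzelTop_of_eq_zero n hn i j h, face_north_top n hn i]
    · obtain ⟨_ | j, hj⟩ := j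
      · exact absurd rfl h
      · have := (pretzel_face_edge n hn (pretzel_nbr_left n hn i j hj)).1
        simpa [faceCode, codeCorner, hj] using this
  | 1 =>
    rw [face_west]
    by_cases h : i = 0
    · subst h
      simp only [faceCode, if_true, codeCorner]
    · simp only [faceCode, h, if_false, hb]
      exact face_west n hn _ _ _
  | 2 =>
    by_cases h : j.1 + 1 < (n i).natAbs
    · simp [faceCode, codeCorner, h]
    · simp only [faceCode, h, if_false, hb, if_true]
      rw [pretzelBottom_of_not_lt n hn i j h, face_south_bottom n hn i]
  | 3 =>
    rw [face_east]
    by_cases h : i + 1 = 0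
    · simp only [faceCode, if_true, codeCorner, h]
    · simp only [faceCode, h, if_false, hb]
      exact face_west n hn _ _ _

/-- The faces of the pretzel diagram. -/
def faceEquiv : (pretzelDiagram n hn).Face ≃ Bool ⊕ PretzelCrossing n where
  toFun := Quot.lift (faceCode n hn) (by
    rintro c c' rfl
    exact (faceCode_edge n hn c).1)
  invFun f := (pretzelDiagram n hn).face (codeCorner n hn f)
  left_inv := by
    rintro ⟨c⟩
    exact face_codeCorner_faceCode n hn c
  right_inv f := faceCode_codeCorner n hn f

theorem faceEquiv_face (c : PretzelCrossing n × Fin 4) :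
    faceEquiv n hn ((pretzelDiagram n hn).face c) = faceCode n hn c := rfl

theorem face_eq_iff (c c' : PretzelCrossing n × Fin 4) :
    (pretzelDiagram n hn).face c = (pretzelDiagram n hn).face c' ↔
      faceCode n hn c = faceCode n hn c' :=
  (faceEquiv n hn).injective.eq_iff.symm

theorem faceEquiv_upperDeck : faceEquiv n hn (upperDeck n hn) = .inl true := rfl

theorem faceEquiv_universalFace : faceEquiv n hn (universalFace n hn) = .inl false := rfl

/-- The crossings correspond to the faces of the balanced overlaid Tait graph. -/
def balancedFaceEquiv : PretzelCrossing n ≃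
    {f : (pretzelDiagram n hn).Face // f ≠ upperDeck n hn ∧ f ≠ universalFace n hn} where
  toFun x := ⟨(faceEquiv n hn).symm (.inr x), by
    simp [Equiv.symm_apply_eq, faceEquiv_upperDeck, faceEquiv_universalFace]⟩
  invFun f := ((faceEquiv n hn f.1).elim (fun _ => pretzelTop n hn 0) id)
  left_inv x := by simp
  right_inv f := by
    obtain ⟨f, h1, h2⟩ := f
    obtain ⟨f, rfl⟩ := (faceEquiv n hn).symm.surjective f
    rcases f with (_ | _) | x
    · exact absurd rfl h2
    · exact absurd rfl h1
    · simp

theorem face_eq_balancedFaceEquiv_iff (c : PretzelCrossing n × Fin 4) (y : PretzelCrossing n) :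
    (pretzelDiagram n hn).face c = (balancedFaceEquiv n hn y).1 ↔ faceCode n hn c = .inr y := by
  rw [← faceEquiv_face, ← Equiv.eq_symm_apply]
  rfl

end

section
variable {k : ℕ} [NeZero k] (n : Fin k → ℤ) (hn : ∀ i, n i ≠ 0)

/-! ## Activities of the corners of the pretzel diagram -/

theorem Fin.lt_add_one_of_ne_zero (i : Fin k) (h : i + 1 ≠ 0) : i < i + 1 := by
  obtain ⟨k, rfl⟩ := Nat.exists_eq_succ_of_ne_zero (NeZero.ne k)
  rw [Fin.lt_def, Fin.val_add_one]
  split_ifs with hi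
  · exact absurd (by rw [hi]; exact Fin.last_add_one k) h
  · omega

theorem Fin.sub_one_lt_of_ne_zero' (i : Fin k) (h : i ≠ 0) : i - 1 < i := by
  have := Fin.lt_add_one_of_ne_zero (i - 1) (by rwa [sub_add_cancel])
  rwa [sub_add_cancel] at this

theorem pretzelCrossing_eq_iff {i i' : Fin k} {j : Fin (n i).natAbs} {j' : Fin (n i').natAbs} :
    (⟨i, j⟩ : PretzelCrossing n) = ⟨i', j'⟩ ↔ i = i' ∧ j.1 = j'.1 := by
  constructor
  · intro h
    cases h
    exact ⟨rfl, rfl⟩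
  · rintro ⟨rfl, h⟩
    rw [Fin.ext h]

theorem pretzelLabel_lt_of_lt {i i' : Fin k} (h : i < i') (j : Fin (n i).natAbs)
    (j' : Fin (n i').natAbs) : pretzelLabel n ⟨i, j⟩ < pretzelLabel n ⟨i', j'⟩ := by
  have h1 : ∑ l ∈ Finset.univ.filter (· < i), (n l).natAbs + (n i).natAbs ≤
      ∑ l ∈ Finset.univ.filter (· < i'), (n l).natAbs := by
    rw [add_comm, ← Finset.sum_insert (f := fun l => (n l).natAbs) (by simp)]
    refine Finset.sum_le_sum_of_subset fun l hl => ?_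
    simp only [Finset.mem_insert, Finset.mem_filter, Finset.mem_univ, true_and] at hl ⊢
    rcases hl with rfl | hl
    · exact h
    · exact hl.trans h
  have hi' : i' ≠ 0 := fun h0 => absurd (Fin.zero_le i) (by rw [← h0]; exact not_le_of_gt h)
  simp only [pretzelLabel, hi', if_false]
  split_ifs <;> omega

theorem pretzelLabel_le_iff_of_zero {j j' : Fin (n 0).natAbs} :
    pretzelLabel n ⟨0, j⟩ ≤ pretzelLabel n ⟨0, j'⟩ ↔ j.1 ≤ j'.1 := by
  simp [pretzelLabel]

theorem pretzelLabel_le_iff_of_ne_zero {i : Fin k} (hi : i ≠ 0) {j j' : Fin (n i).natAbs} :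
    pretzelLabel n ⟨i, j⟩ ≤ pretzelLabel n ⟨i, j'⟩ ↔ j'.1 ≤ j.1 := by
  simp only [pretzelLabel, hi, if_false]
  omega

theorem pretzel_isLive_iff (c : PretzelCrossing n × Fin 4) :
    (pretzelDiagram n hn).IsLive (pretzelLabel n) c ↔
      ∀ c', faceCode n hn c' = faceCode n hn c → pretzelLabel n c.1 ≤ pretzelLabel n c'.1 := by
  simp only [LinkDiagram.IsLive, face_eq_iff]

/-- Labels increase downwards in the first column only; elsewhere the crossing just below, or for
the south face the bottom of the first column, has a smaller label. -/
theorem isLive_south (i : Fin k) (j : Fin (n i).natAbs) :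
    (pretzelDiagram n hn).IsLive (pretzelLabel n) (⟨i, j⟩, 2) ↔ i = 0 := by
  rw [pretzel_isLive_iff]
  constructor
  · intro h
    by_contra hi
    by_cases hj : j.1 + 1 < (n i).natAbs
    · have := h (⟨i, j.1 + 1, hj⟩, 0) (by simp [faceCode, hj])
      rw [pretzelLabel_le_iff_of_ne_zero n hi] at this
      simp at this
    · have := h (pretzelBottom n hn 0, 2) (by
        simp only [faceCode, pretzelBottom, hj, natAbs_sub_one_add_one_not_lt, if_false])
      exact absurd (pretzelLabel_lt_of_lt n (Fin.pos_iff_ne_zero.2 hi) _ _) (not_lt_of_ge this)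
  · rintro rfl ⟨⟨i', j'⟩, p⟩ h
    by_cases hi' : i' = 0
    · subst hi'
      have hc : faceCode n hn (⟨0, j⟩, 2) = .inr ⟨0, j⟩ := by
        by_cases hj : j.1 + 1 < (n 0).natAbs
        · simp [faceCode, hj]
        · simp only [faceCode, hj, if_false]
          rw [pretzelBottom_of_not_lt n hn 0 j hj]
      rw [hc] at h
      rw [pretzelLabel_le_iff_of_zero]
      match p, h with
      | 0, h =>
        simp only [faceCode] at h
        split_ifs at h with hj'
        have := (pretzelCrossing_eq_iff n).1 (Sum.inr.inj h)
        simp only at this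
        omega
      | 1, h => simp [faceCode] at h
      | 2, h =>
        simp only [faceCode] at h
        split_ifs at h with hj'
        · have := (pretzelCrossing_eq_iff n).1 (Sum.inr.inj h)
          omega
        · have := (pretzelCrossing_eq_iff n).1 (Sum.inr.inj h)
          simp only at this
          omega
      | 3, h =>
        simp only [faceCode] at h
        split_ifs at h with h0
        exact absurd ((pretzelCrossing_eq_iff n).1 (Sum.inr.inj h)).1 h0
    · exact (pretzelLabel_lt_of_lt n (Fin.pos_iff_ne_zero.2 hi') _ _).le

/-- The mirror image of `isLive_south`. Top crossings are left out because their northern face is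
the deleted upper deck. -/
theorem isLive_north (i : Fin k) (j : ℕ) (hj : j + 1 < (n i).natAbs) :
    (pretzelDiagram n hn).IsLive (pretzelLabel n) (⟨i, j + 1, hj⟩, 0) ↔ i ≠ 0 := by
  rw [pretzel_isLive_iff]
  constructor
  · rintro h rfl
    have := h (⟨0, j, by omega⟩, 2) (by simp [faceCode, hj])
    rw [pretzelLabel_le_iff_of_zero] at this
    simp at this
  · rintro hi ⟨⟨i', j'⟩, p⟩ h
    have hc : faceCode n hn (⟨i, j + 1, hj⟩, 0) = .inr ⟨i, j, by omega⟩ := by simp [faceCode]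
    rw [hc] at h
    match p, h with
    | 0, h =>
      simp only [faceCode] at h
      split_ifs at h with hj'
      obtain ⟨rfl, this⟩ := (pretzelCrossing_eq_iff n).1 (Sum.inr.inj h)
      rw [pretzelLabel_le_iff_of_ne_zero n hi]
      simp only at this ⊢
      omega
    | 1, h =>
      simp only [faceCode] at h
      split_ifs at h with hj'
      obtain ⟨rfl, this⟩ := (pretzelCrossing_eq_iff n).1 (Sum.inr.inj h)
      simp only at this
      omega
    | 2, h =>
      simp only [faceCode] at h
      split_ifs at h with hj'
      · obtain ⟨rfl, this⟩ := (pretzelCrossing_eq_iff n).1 (Sum.inr.inj h)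
        rw [pretzelLabel_le_iff_of_ne_zero n hi]
        simp only at this ⊢
        omega
      · exact absurd ((pretzelCrossing_eq_iff n).1 (Sum.inr.inj h)).1.symm hi
    | 3, h =>
      simp only [faceCode] at h
      split_ifs at h with hj'
      obtain ⟨rfl, this⟩ := (pretzelCrossing_eq_iff n).1 (Sum.inr.inj h)
      simp only at this
      omega

/-- The same white face touches the previous column, where all labels are smaller. -/
theorem not_isLive_west (i : Fin k) (hi : i ≠ 0) (j : Fin (n i).natAbs) :
    ¬ (pretzelDiagram n hn).IsLive (pretzelLabel n) (⟨i, j⟩, 1) := by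
  rw [pretzel_isLive_iff]
  intro h
  have := h (pretzelBottom n hn (i - 1), 3) (by
    change (if i - 1 + 1 = 0 then Sum.inl false else
      Sum.inr (pretzelBottom n hn (i - 1 + 1))) = _
    rw [sub_add_cancel]
    rfl)
  exact absurd (pretzelLabel_lt_of_lt n (Fin.sub_one_lt_of_ne_zero' i hi) _ _) (not_lt_of_ge this)

/-- Column `i` precedes the other column at this white face, so the minimum is attained at the
crossing of column `i` that is labelled first: its top if `i = 0`, its bottom otherwise. -/
theorem isLive_east (i : Fin k) (hi : i + 1 ≠ 0) (j : Fin (n i).natAbs) :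
    (pretzelDiagram n hn).IsLive (pretzelLabel n) (⟨i, j⟩, 3) ↔
      if i = 0 then j.1 = 0 else j.1 = (n i).natAbs - 1 := by
  rw [pretzel_isLive_iff]
  constructor
  · intro h
    split_ifs with h0
    · subst h0
      have := h (pretzelTop n hn 0, 3) rfl
      simp only [pretzelTop] at this
      rw [pretzelLabel_le_iff_of_zero] at this
      simpa using this
    · have := h (pretzelBottom n hn i, 3) rfl
      simp only [pretzelBottom] at this
      rw [pretzelLabel_le_iff_of_ne_zero n h0] at this
      simp only at this
      omega
  · rintro hl ⟨⟨i', j'⟩, p⟩ h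
    have hc : faceCode n hn (⟨i, j⟩, 3) = .inr (pretzelBottom n hn (i + 1)) := by
      simp [faceCode, hi]
    rw [hc] at h
    have hlt : ∀ j' : Fin (n (i + 1)).natAbs,
        pretzelLabel n ⟨i, j⟩ ≤ pretzelLabel n ⟨i + 1, j'⟩ := fun j' =>
      (pretzelLabel_lt_of_lt n (Fin.lt_add_one_of_ne_zero i hi) _ _).le
    match p, h with
    | 0, h =>
      simp only [faceCode] at h
      split_ifs at h with hj'
      obtain ⟨rfl, this⟩ := (pretzelCrossing_eq_iff n).1 (Sum.inr.inj h)
      exact hlt _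
    | 1, h =>
      simp only [faceCode] at h
      split_ifs at h with hj'
      obtain ⟨rfl, this⟩ := (pretzelCrossing_eq_iff n).1 (Sum.inr.inj h)
      exact hlt _
    | 2, h =>
      simp only [faceCode] at h
      split_ifs at h with hj'
      · obtain ⟨rfl, this⟩ := (pretzelCrossing_eq_iff n).1 (Sum.inr.inj h)
        exact hlt _
      · exact absurd ((pretzelCrossing_eq_iff n).1 (Sum.inr.inj h)).1.symm hi
    | 3, h =>
      simp only [faceCode] at h
      split_ifs at h with hj'
      obtain ⟨hii, this⟩ := (pretzelCrossing_eq_iff n).1 (Sum.inr.inj h)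
      obtain rfl : i' = i := add_right_cancel hii
      split_ifs at hl with h0
      · subst h0
        rw [pretzelLabel_le_iff_of_zero]
        omega
      · rw [pretzelLabel_le_iff_of_ne_zero n h0]
        have := j'.2
        omega

/-- The variable `A` in the columns with `n_i > 0`, its inverse in the others. -/
def columnVar {k : ℕ} (n : Fin k → ℤ) (i : Fin k) : (LaurentPolynomial ℤ)ˣ :=
  if 0 < n i then LinkDiagram.varA else LinkDiagram.varA⁻¹

-- A barred letter is the unbarred one with `A` replaced by `A⁻¹`, so both signs of `n_i` are
-- treated uniformly through `columnVar`.
open Classical in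
theorem pretzel_activity_eval (x : PretzelCrossing n) (p : Fin 4) :
    ((pretzelDiagram n hn).activity (pretzelLabel n) (x, p)).eval =
      if evenPos p then
        if (pretzelDiagram n hn).IsLive (pretzelLabel n) (x, p) then
          -(columnVar n x.1 ^ (-3 : ℤ)) else columnVar n x.1
      else if (pretzelDiagram n hn).IsLive (pretzelLabel n) (x, p) then
          -(columnVar n x.1 ^ (3 : ℤ)) else columnVar n x.1 ^ (-1 : ℤ) := by
  have hb : ((pretzelDiagram n hn).face (x, p)).black = evenPos p := rfl
  have ht : (pretzelDiagram n hn).taitPositive x = decide (0 < n x.1) := rfl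
  simp only [LinkDiagram.activity, hb, ht, columnVar]
  by_cases h1 : 0 < n x.1 <;> cases h2 : evenPos p <;>
    by_cases h3 : (pretzelDiagram n hn).IsLive (pretzelLabel n) (x, p) <;>
    simp [h1, h3, LinkDiagram.ActivityLetter.eval]

end

namespace LinkDiagram
variable {C : Type} {D : LinkDiagram C} (o : D.Orientation)

/-! ## The signs of the corners -/

/-- The sign `kappa` of a corner, as a unit of the integers. -/
def Orientation.cornerSign (c : C × Fin 4) : ℤˣ :=
  if o.out c = true ∧ o.out (c.1, c.2 + 1) = true then -1 else 1

theorem Orientation.kappa_eq (c : C × Fin 4) :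
    ((o.kappa c : (LaurentPolynomial ℤ)ˣ) : LaurentPolynomial ℤ) =
      (((o.cornerSign c : ℤˣ) : ℤ) : LaurentPolynomial ℤ) := by
  unfold kappa cornerSign
  split_ifs <;> simp

/-- The darts `p - 1` and `p + 1` are opposite, so exactly one of them is outgoing. If `p` is
outgoing as well, exactly one of the two corners beside it is negative; if not, neither is. -/
theorem Orientation.cornerSign_mul_prev (x : C) (p : Fin 4) :
    o.cornerSign (x, p - 1) * o.cornerSign (x, p) = if o.out (x, p) then -1 else 1 := by
  have h : o.out (x, p + 1) = !o.out (x, p - 1) := by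
    rw [← o.out_opp]
    congr 2
    revert p
    decide
  simp only [cornerSign, sub_add_cancel, h]
  cases o.out (x, p) <;> cases o.out (x, p - 1) <;> simp

/-- The product of the signs of the four corners at the ends of an edge is `-1`. -/
theorem Orientation.cornerSign_edge {x y : C} {p q : Fin 4} (h : D.nbr (x, p) = (y, q)) :
    (o.cornerSign (x, p - 1) * o.cornerSign (x, p)) *
      (o.cornerSign (y, q - 1) * o.cornerSign (y, q)) = -1 := by
  have h' := o.out_nbr (x, p)
  rw [h] at h'
  rw [cornerSign_mul_prev, cornerSign_mul_prev, h']
  cases o.out (x, p) <;> simp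

theorem prod_zpow_eq_zpow_sum {ι G : Type*} [CommGroup G] (s : Finset ι) (a : G) (f : ι → ℤ) :
    ∏ x ∈ s, a ^ f x = a ^ ∑ x ∈ s, f x := by
  classical
  induction s using Finset.induction_on with
  | empty => simp
  | insert x s hx ih => rw [Finset.prod_insert hx, Finset.sum_insert hx, ih, zpow_add]

theorem Orientation.writheWeight_eq (x : C) :
    o.writheWeight x = (-(varA ^ (-3 : ℤ))) ^ o.sign x := by
  unfold writheWeight sign
  split_ifs
  · rw [zpow_one, Odd.neg_zpow (by decide)]
  · rw [Odd.neg_zpow (by decide), Odd.neg_zpow (by decide), ← zpow_mul]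
    norm_num

theorem Orientation.prod_writheWeight [Fintype C] :
    ∏ x, o.writheWeight x = (-(varA ^ (-3 : ℤ))) ^ o.writhe := by
  simp only [writheWeight_eq, prod_zpow_eq_zpow_sum]
  rfl

end LinkDiagram

/-! ### Corner signs in standard form -/

section
variable {k : ℕ} [NeZero k] (n : Fin k → ℤ) (hn : ∀ i, n i ≠ 0)
variable (o : (pretzelDiagram n hn).Orientation)

/-- The signs of the corners of a pretzel diagram after a change of gauge. -/
def standardSign (p : Fin 4) : ℤˣ := if p = 0 ∨ p = 3 then -1 else 1

theorem standardSign_north : standardSign 0 = -1 := rfl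

theorem standardSign_west : standardSign 1 = 1 := rfl

theorem standardSign_south : standardSign 2 = 1 := rfl

theorem standardSign_east : standardSign 3 = -1 := rfl

/-- The change of gauge at a crossing. -/
def rowSign (x : PretzelCrossing n) : ℤˣ :=
  o.cornerSign (x, 1) *
    (o.cornerSign (pretzelBottom n hn x.1, 1) * o.cornerSign (pretzelBottom n hn x.1, 2))

/-- The change of gauge at the face of a corner. -/
def cornerGauge (c : PretzelCrossing n × Fin 4) : ℤˣ :=
  standardSign c.2 * (o.cornerSign c * rowSign n hn o c.1)

/-- `rowSign` is chosen to make the gauge constant on the western corners of a column. By the edge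
condition, which `standardSign` satisfies as well, agreement on one side of an edge forces agreement
on the other. -/
theorem cornerGauge_left {i : Fin k} {j : ℕ} (h : j + 1 < (n i).natAbs) :
    cornerGauge n hn o (⟨i, j, by omega⟩, 2) = cornerGauge n hn o (⟨i, j + 1, h⟩, 0) ∧
    cornerGauge n hn o (⟨i, j + 1, h⟩, 1) = cornerGauge n hn o (⟨i, j, by omega⟩, 1) := by
  have e := o.cornerSign_edge (pretzel_nbr_left n hn i j h)
  simp only [show (2 : Fin 4) - 1 = 1 from rfl, show (1 : Fin 4) - 1 = 0 from rfl] at e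
  simp only [cornerGauge, rowSign, standardSign_north, standardSign_west,
    standardSign_south]
  generalize o.cornerSign (pretzelBottom n hn i, 1) * o.cornerSign (pretzelBottom n hn i, 2) = g
  generalize o.cornerSign (⟨i, j, _⟩, 1) = a at *
  generalize o.cornerSign (⟨i, j, _⟩, 2) = b at *
  generalize o.cornerSign (⟨i, j + 1, _⟩, 0) = c at *
  generalize o.cornerSign (⟨i, j + 1, _⟩, 1) = d at *
  -- Only a statement about finitely many signs is left.
  revert a b c d g
  decide

theorem cornerGauge_right {i : Fin k} {j : ℕ} (h : j + 1 < (n i).natAbs) :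
    cornerGauge n hn o (⟨i, j + 1, h⟩, 3) = cornerGauge n hn o (⟨i, j, by omega⟩, 3) := by
  have e := o.cornerSign_edge (pretzel_nbr_right n hn i j h)
  have e' := (cornerGauge_left n hn o h).1
  simp only [show (3 : Fin 4) - 1 = 2 from rfl, show (0 : Fin 4) - 1 = 3 from rfl] at e
  simp only [cornerGauge, standardSign_north, standardSign_south,
    standardSign_east] at *
  generalize rowSign n hn o ⟨i, j, _⟩ = g at *
  generalize rowSign n hn o ⟨i, j + 1, _⟩ = g' at *
  generalize o.cornerSign (⟨i, j, _⟩, 3) = a at *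
  generalize o.cornerSign (⟨i, j, _⟩, 2) = b at *
  generalize o.cornerSign (⟨i, j + 1, _⟩, 0) = c at *
  generalize o.cornerSign (⟨i, j + 1, _⟩, 3) = d at *
  revert a b c d g g'
  decide

theorem cornerGauge_west (i : Fin k) (j : Fin (n i).natAbs) :
    cornerGauge n hn o (⟨i, j⟩, 1) = cornerGauge n hn o (pretzelTop n hn i, 1) := by
  obtain ⟨j, hj⟩ := j
  induction j with
  | zero => rfl
  | succ j ih => exact (cornerGauge_left n hn o hj).2.trans (ih _)

theorem cornerGauge_east (i : Fin k) (j : Fin (n i).natAbs) :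
    cornerGauge n hn o (⟨i, j⟩, 3) = cornerGauge n hn o (pretzelTop n hn i, 3) := by
  obtain ⟨j, hj⟩ := j
  induction j with
  | zero => rfl
  | succ j ih => exact (cornerGauge_right n hn o hj).trans (ih _)

/-- The second factor of `rowSign` serves to normalize the gauge of the south face to 1. -/
theorem cornerGauge_bottom (i : Fin k) :
    cornerGauge n hn o (pretzelBottom n hn i, 2) = 1 := by
  simp only [cornerGauge, rowSign, pretzelBottom, standardSign_south]
  generalize o.cornerSign (⟨i, _, _⟩, 1) = a
  generalize o.cornerSign (⟨i, _, _⟩, 2) = b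
  revert a b
  decide

theorem cornerGauge_bottom_edge (i : Fin k) :
    cornerGauge n hn o (pretzelBottom n hn i, 3) =
      cornerGauge n hn o (pretzelBottom n hn (i + 1), 1) := by
  have e := o.cornerSign_edge (pretzel_nbr_bottom n hn i)
  have h1 := cornerGauge_bottom n hn o i
  have h2 := cornerGauge_bottom n hn o (i + 1)
  simp only [show (3 : Fin 4) - 1 = 2 from rfl, show (2 : Fin 4) - 1 = 1 from rfl] at e
  simp only [cornerGauge, standardSign_west, standardSign_south,
    standardSign_east] at *
  generalize rowSign n hn o (pretzelBottom n hn i) = g at *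
  generalize rowSign n hn o (pretzelBottom n hn (i + 1)) = g' at *
  generalize o.cornerSign (pretzelBottom n hn i, 2) = a at *
  generalize o.cornerSign (pretzelBottom n hn i, 3) = b at *
  generalize o.cornerSign (pretzelBottom n hn (i + 1), 1) = c at *
  generalize o.cornerSign (pretzelBottom n hn (i + 1), 2) = d at *
  revert a b c d g g'
  decide

/-- Agreement on the white side is carried up from the bottom edge, since the gauge is constant
along both sides of a column; the edge condition then gives agreement on the upper deck. -/
theorem cornerGauge_top_edge (i : Fin k) :
    cornerGauge n hn o (pretzelTop n hn i, 0) = cornerGauge n hn o (pretzelTop n hn (i + 1), 0) ∧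
    cornerGauge n hn o (pretzelTop n hn (i + 1), 1) =
      cornerGauge n hn o (pretzelTop n hn i, 3) := by
  have h : cornerGauge n hn o (pretzelTop n hn (i + 1), 1) =
      cornerGauge n hn o (pretzelTop n hn i, 3) := by
    rw [← cornerGauge_west n hn o (i + 1) (pretzelBottom n hn (i + 1)).2,
      ← cornerGauge_east n hn o i (pretzelBottom n hn i).2]
    exact (cornerGauge_bottom_edge n hn o i).symm
  refine ⟨?_, h⟩
  have e := o.cornerSign_edge (pretzel_nbr_top n hn i)
  simp only [show (0 : Fin 4) - 1 = 3 from rfl, show (1 : Fin 4) - 1 = 0 from rfl] at e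
  simp only [cornerGauge, standardSign_north, standardSign_west,
    standardSign_east] at *
  generalize rowSign n hn o (pretzelTop n hn i) = g at *
  generalize rowSign n hn o (pretzelTop n hn (i + 1)) = g' at *
  generalize o.cornerSign (pretzelTop n hn i, 3) = a at *
  generalize o.cornerSign (pretzelTop n hn i, 0) = b at *
  generalize o.cornerSign (pretzelTop n hn (i + 1), 0) = c at *
  generalize o.cornerSign (pretzelTop n hn (i + 1), 1) = d at *
  revert a b c d g g'
  decide

theorem cornerGauge_edge (d : PretzelCrossing n × Fin 4) :
    cornerGauge n hn o d = cornerGauge n hn o ((pretzelDiagram n hn).nextCorner d) ∧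
      cornerGauge n hn o ((pretzelDiagram n hn).nbr d) = cornerGauge n hn o (d.1, d.2 - 1) := by
  refine pretzel_edge_cases n hn
    (P := fun d d' => cornerGauge n hn o d = cornerGauge n hn o (d'.1, d'.2 - 1) ∧
      cornerGauge n hn o d' = cornerGauge n hn o (d.1, d.2 - 1))
    (fun _ _ h => ⟨h.2, h.1⟩) ?_ ?_ ?_ ?_ d
  · exact fun i => cornerGauge_top_edge n hn o i
  · exact fun i => ⟨cornerGauge_bottom_edge n hn o i,
      (cornerGauge_bottom n hn o (i + 1)).trans (cornerGauge_bottom n hn o i).symm⟩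
  · exact fun i j h => cornerGauge_left n hn o h
  · exact fun i j h => ⟨(cornerGauge_right n hn o h).symm, (cornerGauge_left n hn o h).1.symm⟩

/-- The change of gauge at a face. -/
def faceGauge : (pretzelDiagram n hn).Face → ℤˣ :=
  Quot.lift (cornerGauge n hn o) (by
    rintro c c' rfl
    exact (cornerGauge_edge n hn o c).1)

theorem cornerSign_eq_gauge (x : PretzelCrossing n) (p : Fin 4) :
    o.cornerSign (x, p) =
      rowSign n hn o x * (faceGauge n hn o ((pretzelDiagram n hn).face (x, p)) *
        standardSign p) := by
  change _ = _ * (cornerGauge n hn o (x, p) * _)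
  simp only [cornerGauge]
  generalize o.cornerSign (x, p) = a
  generalize rowSign n hn o x = b
  generalize standardSign p = c
  revert a b c
  decide

/-- The activity matrix without writhe and with the signs in standard form. -/
def standardMatrix : Matrix (PretzelCrossing n) (PretzelCrossing n) (LaurentPolynomial ℤ) :=
  Matrix.of fun x y => ∑ p : Fin 4, if faceCode n hn (x, p) = .inr y then
    ((standardSign p : ℤ) : LaurentPolynomial ℤ) *
      (((pretzelDiagram n hn).activity (pretzelLabel n) (x, p)).eval : (LaurentPolynomial ℤ)ˣ)
    else 0

theorem activityMatrix_eq (x y : PretzelCrossing n) :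
    o.activityMatrix (pretzelLabel n) (upperDeck n hn) (universalFace n hn) x
      (balancedFaceEquiv n hn y) =
    ((o.writheWeight x : (LaurentPolynomial ℤ)ˣ) : LaurentPolynomial ℤ) *
      (((rowSign n hn o x : ℤ) : LaurentPolynomial ℤ) *
      (((faceGauge n hn o (balancedFaceEquiv n hn y).1 : ℤ) : LaurentPolynomial ℤ) *
        standardMatrix n hn x y)) := by
  simp only [LinkDiagram.Orientation.activityMatrix, standardMatrix, Matrix.of_apply,
    Finset.mul_sum]
  refine Finset.sum_congr rfl fun p _ => ?_
  have hf := face_eq_balancedFaceEquiv_iff n hn (x, p) y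
  by_cases h : (pretzelDiagram n hn).face (x, p) = (balancedFaceEquiv n hn y).1
  · rw [if_pos h, if_pos (hf.1 h), Units.val_mul, Units.val_mul, o.kappa_eq, cornerSign_eq_gauge, h]
    push_cast
    ring
  · rw [if_neg h, if_neg (mt hf.2 h)]
    simp

theorem units_prod_eq_one_or_neg_one {ι : Type*} (s : Finset ι) (f : ι → ℤˣ) :
    (∏ x ∈ s, ((f x : ℤ) : LaurentPolynomial ℤ)) = 1 ∨
      (∏ x ∈ s, ((f x : ℤ) : LaurentPolynomial ℤ)) = -1 := by
  have h : (∏ x ∈ s, ((f x : ℤ) : LaurentPolynomial ℤ)) =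
      (((∏ x ∈ s, f x : ℤˣ) : ℤ) : LaurentPolynomial ℤ) := by
    push_cast
    rfl
  rw [h]
  rcases Int.units_eq_one_or (∏ x ∈ s, f x) with h | h <;> simp [h]

/-- The sign `ε` collects the row signs, the face signs and the sign of the permutation comparing
`e` with `balancedFaceEquiv`; the writhe weights multiply to the normalizing factor of the Jones
polynomial. -/
theorem activityMatrix_det (e : PretzelCrossing n ≃
      {f : (pretzelDiagram n hn).Face // f ≠ upperDeck n hn ∧ f ≠ universalFace n hn}) :
    ∃ ε : LaurentPolynomial ℤ, (ε = 1 ∨ ε = -1) ∧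
      ((o.activityMatrix (pretzelLabel n) (upperDeck n hn) (universalFace n hn)).submatrix
          id e).det =
        ε * ((((-(LinkDiagram.varA ^ (-3 : ℤ))) ^ o.writhe : (LaurentPolynomial ℤ)ˣ) :
          LaurentPolynomial ℤ) * (standardMatrix n hn).det) := by
  set M := o.activityMatrix (pretzelLabel n) (upperDeck n hn) (universalFace n hn)
  have h1 : M.submatrix id e = (M.submatrix id (balancedFaceEquiv n hn)).submatrix id
      (e.trans (balancedFaceEquiv n hn).symm) := by
    refine Matrix.ext fun x y => ?_
    simp
  have h2 : M.submatrix id (balancedFaceEquiv n hn) = Matrix.of fun x y =>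
      ((o.writheWeight x : (LaurentPolynomial ℤ)ˣ) : LaurentPolynomial ℤ) *
      (Matrix.of fun x y => (((rowSign n hn o x : ℤ) : LaurentPolynomial ℤ) *
      (Matrix.of fun x y =>
        (((faceGauge n hn o (balancedFaceEquiv n hn y).1 : ℤ) : LaurentPolynomial ℤ) *
        standardMatrix n hn x y)) x y)) x y := by
    refine Matrix.ext fun x y => ?_
    exact activityMatrix_eq n hn o x y
  have h3 : ∏ x, ((o.writheWeight x : (LaurentPolynomial ℤ)ˣ) : LaurentPolynomial ℤ) =
      (((-(LinkDiagram.varA ^ (-3 : ℤ))) ^ o.writhe : (LaurentPolynomial ℤ)ˣ) :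
          LaurentPolynomial ℤ) := by
    rw [← o.prod_writheWeight, Units.coe_prod]
  rw [h1, Matrix.det_permute', h2, Matrix.det_mul_column, Matrix.det_mul_column,
    Matrix.det_mul_row, h3]
  refine ⟨((Equiv.Perm.sign (e.trans (balancedFaceEquiv n hn).symm) : ℤˣ) : ℤ) *
    ((∏ x, ((rowSign n hn o x : ℤ) : LaurentPolynomial ℤ)) *
      ∏ x, ((faceGauge n hn o (balancedFaceEquiv n hn x).1 : ℤ) : LaurentPolynomial ℤ)), ?_, ?_⟩
  · rcases Int.units_eq_one_or (Equiv.Perm.sign (e.trans (balancedFaceEquiv n hn).symm)) with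
      h | h <;>
    rcases units_prod_eq_one_or_neg_one Finset.univ (rowSign n hn o) with h' | h' <;>
    rcases units_prod_eq_one_or_neg_one Finset.univ
      (fun x => faceGauge n hn o (balancedFaceEquiv n hn x).1) with h'' | h'' <;>
    rw [h, h', h''] <;> simp
  · ring

end

/-! ## The determinant of the activity matrix -/

theorem Fin.prod_ite_succ_lt {R : Type*} [CommMonoid R] {m : ℕ} (a : R) (hm : 0 < m) :
    ∏ j : Fin m, (if j.1 + 1 < m then a else 1) = a ^ (m - 1) := by
  obtain ⟨m, rfl⟩ := Nat.exists_eq_succ_of_ne_zero hm.ne'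
  rw [Fin.prod_univ_castSucc]
  simp

theorem Fin.prod_ite_succ_lt' {R : Type*} [CommMonoid R] {m : ℕ} (f : ℕ → R) (hm : 0 < m) :
    ∏ j : Fin m, (if j.1 + 1 < m then 1 else f j.1) = f (m - 1) := by
  obtain ⟨m, rfl⟩ := Nat.exists_eq_succ_of_ne_zero hm.ne'
  rw [Fin.prod_univ_castSucc]
  simp

section
variable {k : ℕ} {m : Fin k → ℕ} {R : Type*} [CommRing R]

/-- The row operations that eliminate the inner entries of the columns of crossings. -/
def columnElimination (a b : Fin k → R) : Matrix (Σ i, Fin (m i)) (Σ i, Fin (m i)) R :=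
  Matrix.of fun x z => if x.2.1 + 1 < m x.1 then if z = x then 1 else 0
    else if z.1 = x.1 then a z.1 ^ z.2.1 * b z.1 ^ (m z.1 - 1 - z.2.1) else 0

theorem columnElimination_det (hm : ∀ i, 0 < m i) (a b : Fin k → R) :
    (columnElimination (m := m) a b).det = ∏ i, a i ^ (m i - 1) := by
  rw [Matrix.det_eq_prod_diag_of_rank _ (fun x => x.2.1), Fintype.prod_sigma]
  · refine Finset.prod_congr rfl fun i _ => ?_
    have := Fin.prod_ite_succ_lt' (fun j => a i ^ j * b i ^ (m i - 1 - j)) (hm i)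
    simpa [columnElimination] using this
  · rintro ⟨i, j⟩ ⟨i', j'⟩ hne h
    simp only [columnElimination, Matrix.of_apply] at h
    split_ifs at h with h1 h2 h3
    · exact absurd h2.symm hne
    · exact absurd rfl h
    · change i' = i at h3
      subst h3
      have : j.1 ≠ j'.1 := fun h => hne (by rw [Fin.ext h])
      simp only at h1 ⊢
      have := j'.2
      omega
    · exact absurd rfl h

theorem columnElimination_mul_of_lt (a b : Fin k → R)
    (N : Matrix (Σ i, Fin (m i)) (Σ i, Fin (m i)) R)
    (x y : Σ i, Fin (m i)) (hx : x.2.1 + 1 < m x.1) :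
    ((columnElimination a b * N : Matrix _ _ R)) x y = N x y := by
  rw [Matrix.mul_apply, Finset.sum_eq_single x]
  · simp [columnElimination, hx]
  · intro z _ hz
    simp [columnElimination, hx, hz]
  · simp

theorem columnElimination_mul_of_not_lt (a b : Fin k → R)
    (N : Matrix (Σ i, Fin (m i)) (Σ i, Fin (m i)) R)
    (x y : Σ i, Fin (m i)) (hx : ¬ x.2.1 + 1 < m x.1) :
    ((columnElimination a b * N : Matrix _ _ R)) x y =
      ∑ j : Fin (m x.1), a x.1 ^ j.1 * b x.1 ^ (m x.1 - 1 - j.1) * N ⟨x.1, j⟩ y := by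
  rw [Matrix.mul_apply, Fintype.sum_sigma, Finset.sum_eq_single x.1]
  · simp [columnElimination, hx]
  · intro i _ hi
    refine Finset.sum_eq_zero fun j _ => ?_
    simp [columnElimination, hx, hi]
  · simp

/-- The determinant of a matrix with bidiagonal blocks is reduced to that of a matrix with one row
and one column for each block. -/
theorem det_eq_det_of_bidiagonal_blocks [IsDomain R] (hm : ∀ i, 0 < m i) (a b : Fin k → R)
    (ha : ∀ i, a i ≠ 0) (N : Matrix (Σ i, Fin (m i)) (Σ i, Fin (m i)) R)
    (hN : ∀ i j i' j', j'.1 + 1 < m i' → N ⟨i, j⟩ ⟨i', j'⟩ =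
      if i = i' then if j.1 = j'.1 then a i else if j.1 = j'.1 + 1 then - b i else 0 else 0) :
    N.det = (Matrix.of fun i i' : Fin k => ∑ j : Fin (m i), a i ^ j.1 * b i ^ (m i - 1 - j.1) *
      N ⟨i, j⟩ ⟨i', m i' - 1, Nat.sub_lt (hm i') one_pos⟩).det := by
  have hne : ∏ i, a i ^ (m i - 1) ≠ 0 :=
    Finset.prod_ne_zero_iff.2 fun i _ => pow_ne_zero _ (ha i)
  -- This factor is the determinant of the elimination matrix, and again that of the inner diagonal
  -- block after elimination, so it cancels.
  refine mul_left_cancel₀ hne ?_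
  rw [← columnElimination_det hm a b, ← Matrix.det_mul,
    Matrix.twoBlockTriangular_det _ (fun x : Σ i, Fin (m i) => x.2.1 + 1 < m x.1)]
  · congr 1
    · rw [Matrix.det_eq_prod_diag_of_rank _ (fun x => x.1.2.1), columnElimination_det hm]
      · have h1 : ∀ x : {x : Σ i, Fin (m i) // x.2.1 + 1 < m x.1},
            Matrix.toSquareBlockProp (columnElimination a b * N : Matrix _ _ R)
              (fun x : Σ i, Fin (m i) => x.2.1 + 1 < m x.1) x x = a x.1.1 := by
          rintro ⟨⟨i, j⟩, hx⟩
          simp only [Matrix.toSquareBlockProp_def, Matrix.of_apply]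
          rw [columnElimination_mul_of_lt _ _ _ _ _ hx, hN _ _ _ _ hx]
          simp
        simp only [h1]
        rw [← Finset.prod_subtype (s := Finset.univ.filter
            fun x : Σ i, Fin (m i) => x.2.1 + 1 < m x.1) (by simp)
            (f := fun x : Σ i, Fin (m i) => a x.1), Finset.prod_filter, Fintype.prod_sigma]
        exact Finset.prod_congr rfl fun i _ => Fin.prod_ite_succ_lt (a i) (hm i)
      · rintro ⟨⟨i, j⟩, hx⟩ ⟨⟨i', j'⟩, hy⟩ hxy h
        simp only [Matrix.toSquareBlockProp_def, Matrix.of_apply] at h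
        rw [columnElimination_mul_of_lt _ _ _ _ _ hx, hN _ _ _ _ hy] at h
        split_ifs at h with h1 h2 h3
        · subst h1
          exact absurd (by simp [Fin.ext h2]) hxy
        · change j'.1 < j.1
          rw [h3]
          exact Nat.lt_succ_self _
        · exact absurd rfl h
        · exact absurd rfl h
    · let e : Fin k ≃ {x : Σ i, Fin (m i) // ¬ x.2.1 + 1 < m x.1} :=
        { toFun := fun i => ⟨⟨i, m i - 1, Nat.sub_lt (hm i) one_pos⟩, by simp only; omega⟩
          invFun := fun x => x.1.1
          left_inv := fun i => rfl
          right_inv := by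
            rintro ⟨⟨i, j⟩, hx⟩
            have : j = ⟨m i - 1, Nat.sub_lt (hm i) one_pos⟩ := by
              ext
              simp only at hx ⊢
              have := j.2
              omega
            subst this
            rfl }
      rw [← Matrix.det_submatrix_equiv_self e]
      congr 1
      refine Matrix.ext fun i i' => ?_
      simp only [Matrix.toSquareBlockProp_def, Matrix.of_apply, Matrix.submatrix_apply]
      rw [columnElimination_mul_of_not_lt _ _ _ _ _ (e i).2]
      rfl
  · rintro ⟨i, j⟩ hx ⟨i', j'⟩ hy
    rw [columnElimination_mul_of_not_lt _ _ _ _ _ hx]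
    simp only at hy ⊢
    simp only [hN _ _ _ _ hy]
    by_cases h : i = i'
    · subst h
      simp only [if_true]
      -- An inner column has the entries `a` in row `j'` and `-b` in row `j' + 1`; the multipliers
      -- `a ^ j * b ^ (m - 1 - j)` are the ones for which these two contributions cancel.
      rw [Finset.sum_eq_add (⟨j'.1, by omega⟩ : Fin (m i)) ⟨j'.1 + 1, hy⟩ (by simp [Fin.ext_iff])]
      · have e1 : m i - 1 - j'.1 = (m i - 1 - (j'.1 + 1)) + 1 := by omega
        simp [e1]
        ring
      · rintro l - ⟨h1, h2⟩
        rw [if_neg (fun h => h1 (Fin.ext h)), if_neg (fun h => h2 (Fin.ext h)), mul_zero]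
      · simp
      · simp
    · simp [h]
end

/-! ### The determinant of the standard matrix -/

/-- The value of a loop. -/
def loopValue : LaurentPolynomial ℤ :=
  (-((LinkDiagram.varA ^ (2 : ℤ) : (LaurentPolynomial ℤ)ˣ) : LaurentPolynomial ℤ)
      - ((LinkDiagram.varA ^ (-2 : ℤ) : (LaurentPolynomial ℤ)ˣ) : LaurentPolynomial ℤ))

/-- At `A = 1` the value is `-2`. -/
theorem loopValue_ne_zero : loopValue ≠ 0 := by
  intro h
  have h' := congrArg (LaurentPolynomial.eval₂ (RingHom.id ℤ) 1) h
  have h1 : LaurentPolynomial.eval₂ (RingHom.id ℤ) 1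
      ((LinkDiagram.varA : (LaurentPolynomial ℤ)ˣ) : LaurentPolynomial ℤ) = 1 := by
    simp [LinkDiagram.varA]
  have h2 : LaurentPolynomial.eval₂ (RingHom.id ℤ) 1
      ((LinkDiagram.varA⁻¹ : (LaurentPolynomial ℤ)ˣ) : LaurentPolynomial ℤ) = 1 := by
    change LaurentPolynomial.eval₂ (RingHom.id ℤ) 1 (LaurentPolynomial.T 1) = 1
    simp
  rw [loopValue, zpow_neg, ← inv_zpow, zpow_ofNat, zpow_ofNat, Units.val_pow_eq_pow_val,
    Units.val_pow_eq_pow_val, map_sub, map_neg, map_pow, map_pow, h1, h2] at h'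
  norm_num at h'

section
variable {k : ℕ} [NeZero k] (n : Fin k → ℤ) (hn : ∀ i, n i ≠ 0)

/-- The variable of a column as a Laurent polynomial. -/
def colV (i : Fin k) : LaurentPolynomial ℤ := (columnVar n i : (LaurentPolynomial ℤ)ˣ)

/-- The inverse of the variable of a column as a Laurent polynomial. -/
def colVinv (i : Fin k) : LaurentPolynomial ℤ := ((columnVar n i)⁻¹ : (LaurentPolynomial ℤ)ˣ)

theorem colV_mul_colVinv (i : Fin k) : colV n i * colVinv n i = 1 := by
  simp [colV, colVinv]

/-- The weight of the southern corners of a column. -/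
def southWeight (i : Fin k) : LaurentPolynomial ℤ := if i = 0 then -(colVinv n i ^ 3) else colV n i

/-- The weight of the northern corners of a column. -/
def northWeight (i : Fin k) : LaurentPolynomial ℤ := if i = 0 then colV n i else -(colVinv n i ^ 3)

/-- The weight of the eastern corners of a column. -/
def eastWeight (i : Fin k) (j : ℕ) : LaurentPolynomial ℤ :=
  if (if i = 0 then j = 0 else j = (n i).natAbs - 1) then -(colV n i ^ 3) else colVinv n i

theorem columnVar_zpow_three (i : Fin k) :
    ((columnVar n i ^ (3 : ℤ) : (LaurentPolynomial ℤ)ˣ) : LaurentPolynomial ℤ) = colV n i ^ 3 := by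
  simp [colV, zpow_ofNat]

theorem columnVar_zpow_neg_three (i : Fin k) :
    ((columnVar n i ^ (-3 : ℤ) : (LaurentPolynomial ℤ)ˣ) : LaurentPolynomial ℤ) =
      colVinv n i ^ 3 := by
  rw [zpow_neg, ← inv_zpow, zpow_ofNat, Units.val_pow_eq_pow_val, colVinv]

theorem activity_south (i : Fin k) (j : Fin (n i).natAbs) :
    (((pretzelDiagram n hn).activity (pretzelLabel n) (⟨i, j⟩, 2)).eval : LaurentPolynomial ℤ) =
      southWeight n i := by
  rw [pretzel_activity_eval, if_pos (by rfl)]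
  simp only [isLive_south]
  unfold southWeight
  split_ifs
  · rw [Units.val_neg, columnVar_zpow_neg_three]
  · rfl

theorem activity_north (i : Fin k) (j : ℕ) (hj : j + 1 < (n i).natAbs) :
    (((pretzelDiagram n hn).activity (pretzelLabel n) (⟨i, j + 1, hj⟩, 0)).eval :
      LaurentPolynomial ℤ) = northWeight n i := by
  rw [pretzel_activity_eval, if_pos (by rfl)]
  simp only [isLive_north, northWeight, ne_eq, ite_not]
  split_ifs
  · rfl
  · rw [Units.val_neg, columnVar_zpow_neg_three]

theorem activity_west (i : Fin k) (hi : i ≠ 0) (j : Fin (n i).natAbs) :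
    (((pretzelDiagram n hn).activity (pretzelLabel n) (⟨i, j⟩, 1)).eval : LaurentPolynomial ℤ) =
      colVinv n i := by
  rw [pretzel_activity_eval, if_neg (by simp [evenPos]), if_neg (not_isLive_west n hn i hi j)]
  simp [colVinv]

theorem activity_east (i : Fin k) (hi : i + 1 ≠ 0) (j : Fin (n i).natAbs) :
    (((pretzelDiagram n hn).activity (pretzelLabel n) (⟨i, j⟩, 3)).eval : LaurentPolynomial ℤ) =
      eastWeight n i j := by
  rw [pretzel_activity_eval, if_neg (by simp [evenPos])]
  simp only [isLive_east n hn i hi, eastWeight]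
  by_cases h : (if i = 0 then j.1 = 0 else j.1 = (n i).natAbs - 1)
  · rw [if_pos h, if_pos h, Units.val_neg, columnVar_zpow_three]
  · rw [if_neg h, if_neg h]
    simp [colVinv]

theorem faceCode_north_iff (i i' : Fin k) (j : Fin (n i).natAbs) (j' : Fin (n i').natAbs) :
    faceCode n hn (⟨i, j⟩, 0) = .inr ⟨i', j'⟩ ↔ i = i' ∧ j.1 = j'.1 + 1 := by
  simp only [faceCode]
  split_ifs with h
  · simp [h]
  · rw [Sum.inr.injEq, pretzelCrossing_eq_iff]
    simp only
    omega

theorem faceCode_west_iff (i i' : Fin k) (j : Fin (n i).natAbs) (j' : Fin (n i').natAbs) :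
    faceCode n hn (⟨i, j⟩, 1) = .inr ⟨i', j'⟩ ↔
      i ≠ 0 ∧ i = i' ∧ ¬ j'.1 + 1 < (n i').natAbs := by
  simp only [faceCode]
  split_ifs with h
  · simp [h]
  · rw [Sum.inr.injEq, pretzelBottom, pretzelCrossing_eq_iff]
    have := j'.2
    constructor
    · rintro ⟨rfl, h'⟩
      simp only at h'
      exact ⟨h, rfl, by omega⟩
    · rintro ⟨_, rfl, h'⟩
      exact ⟨rfl, by simp only; omega⟩

theorem faceCode_south_iff (i i' : Fin k) (j : Fin (n i).natAbs) (j' : Fin (n i').natAbs) :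
    faceCode n hn (⟨i, j⟩, 2) = .inr ⟨i', j'⟩ ↔
      if j.1 + 1 < (n i).natAbs then i = i' ∧ j.1 = j'.1
      else i' = 0 ∧ ¬ j'.1 + 1 < (n i').natAbs := by
  simp only [faceCode]
  split_ifs with h
  · rw [Sum.inr.injEq, pretzelCrossing_eq_iff]
  · rw [Sum.inr.injEq, pretzelBottom, pretzelCrossing_eq_iff]
    have := j'.2
    constructor
    · rintro ⟨rfl, h'⟩
      simp only at h'
      exact ⟨rfl, by omega⟩
    · rintro ⟨rfl, h'⟩
      exact ⟨rfl, by simp only; omega⟩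

theorem faceCode_east_iff (i i' : Fin k) (j : Fin (n i).natAbs) (j' : Fin (n i').natAbs) :
    faceCode n hn (⟨i, j⟩, 3) = .inr ⟨i', j'⟩ ↔
      i + 1 ≠ 0 ∧ i + 1 = i' ∧ ¬ j'.1 + 1 < (n i').natAbs := by
  exact faceCode_west_iff n hn (i + 1) i' (pretzelBottom n hn (i + 1)).2 j'

theorem standardMatrix_apply (i i' : Fin k) (j : Fin (n i).natAbs) (j' : Fin (n i').natAbs) :
    standardMatrix n hn ⟨i, j⟩ ⟨i', j'⟩ =
      (if i = i' ∧ j.1 = j'.1 + 1 then - northWeight n i else 0) +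
      (if i ≠ 0 ∧ i = i' ∧ ¬ j'.1 + 1 < (n i').natAbs then colVinv n i else 0) +
      (if (if j.1 + 1 < (n i).natAbs then i = i' ∧ j.1 = j'.1
        else i' = 0 ∧ ¬ j'.1 + 1 < (n i').natAbs) then southWeight n i else 0) +
      (if i + 1 ≠ 0 ∧ i + 1 = i' ∧ ¬ j'.1 + 1 < (n i').natAbs then - eastWeight n i j else 0) := by
  simp only [standardMatrix, Matrix.of_apply, Fin.sum_univ_four, faceCode_north_iff,
    faceCode_west_iff, faceCode_east_iff, faceCode_south_iff, activity_south,
    standardSign_north, standardSign_west, standardSign_south, standardSign_east]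
  congr 1
  · congr 1
    · congr 1
      · split_ifs with h
        · obtain ⟨_ | j, hj⟩ := j
          · simp at h
          · rw [activity_north]
            simp
        · rfl
      · split_ifs with h
        · rw [activity_west n hn i h.1]
          simp
        · rfl
    · split_ifs <;> simp
  · split_ifs with h
    · rw [activity_east n hn i h.1]
      simp
    · rfl

/-- This matrix column is the black face between two neighbouring crossings: it meets the southern
corner of the upper one and, with negative sign, the northern corner of the lower one. -/
theorem standardMatrix_inner (i : Fin k) (j : Fin (n i).natAbs) (i' : Fin k)
    (j' : Fin (n i').natAbs) (h : j'.1 + 1 < (n i').natAbs) :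
    standardMatrix n hn ⟨i, j⟩ ⟨i', j'⟩ = if i = i' then if j.1 = j'.1 then southWeight n i
      else if j.1 = j'.1 + 1 then - northWeight n i else 0 else 0 := by
  rw [standardMatrix_apply]
  simp only [h, not_true_eq_false, and_false, if_false, add_zero]
  by_cases hi : i = i'
  · subst hi
    by_cases h1 : j.1 = j'.1
    · simp [h1, h]
    · simp [h1]
  · simp [hi]

/-- This matrix column is the south face if `i' = 0`, and otherwise the white face between the
columns `i' - 1` and `i'`. -/
theorem standardMatrix_bottom (i : Fin k) (j : Fin (n i).natAbs) (i' : Fin k)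
    (h : (n i').natAbs - 1 < (n i').natAbs) :
    standardMatrix n hn ⟨i, j⟩ ⟨i', (n i').natAbs - 1, h⟩ =
      if i' = 0 then if j.1 + 1 < (n i).natAbs then 0 else southWeight n i
      else if i' = i then colVinv n i else if i' = i + 1 then - eastWeight n i j else 0 := by
  rw [standardMatrix_apply]
  have h1 : ¬ (i = i' ∧ j.1 = (n i').natAbs - 1 + 1) := by
    rintro ⟨rfl, h2⟩
    have := j.2
    omega
  simp only [if_neg h1, natAbs_sub_one_add_one_not_lt, not_false_eq_true, and_true, zero_add]
  have h2 : ¬ (j.1 + 1 < (n i).natAbs ∧ i = i' ∧ j.1 = (n i').natAbs - 1) := by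
    rintro ⟨h2, rfl, h3⟩
    omega
  have h3 : (if j.1 + 1 < (n i).natAbs then i = i' ∧ j.1 = (n i').natAbs - 1 else i' = 0) ↔
      i' = 0 ∧ ¬ j.1 + 1 < (n i).natAbs := by
    split_ifs with h4
    · exact ⟨fun h5 => absurd ⟨h4, h5⟩ h2, fun h5 => absurd h4 h5.2⟩
    · simp [h4]
  simp only [h3]
  by_cases h0 : i' = 0
  · subst h0
    have h5 : ¬ (i ≠ 0 ∧ i = 0) := by tauto
    have h6 : ¬ (i + 1 ≠ 0 ∧ i + 1 = 0) := by tauto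
    rw [if_neg h5, if_neg h6]
    by_cases h7 : j.1 + 1 < (n i).natAbs <;> simp [h7]
  · simp only [h0, false_and, if_false, add_zero]
    by_cases hi : i' = i
    · subst hi
      have h5 : ¬ (i' + 1 ≠ 0 ∧ i' + 1 = i') := fun h => by
        have := Fin.lt_add_one_of_ne_zero i' h.1
        rw [h.2] at this
        exact lt_irrefl _ this
      rw [if_neg h5]
      simp [h0]
    · have h5 : ¬ (i ≠ 0 ∧ i = i') := fun h => hi h.2.symm
      rw [if_neg h5, zero_add, if_neg hi]
      by_cases h6 : i' = i + 1
      · subst h6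
        simp [h0]
      · have h7 : ¬ (i + 1 ≠ 0 ∧ i + 1 = i') := fun h => h6 h.2.symm
        rw [if_neg h6, if_neg h7]

theorem loopValue_eq (i : Fin k) : loopValue = -(colV n i ^ 2) - colVinv n i ^ 2 := by
  have h2 : LinkDiagram.varA ^ (2 : ℤ) = LinkDiagram.varA ^ 2 := by rfl
  have h3 : LinkDiagram.varA ^ (-2 : ℤ) = LinkDiagram.varA⁻¹ ^ 2 := by
    rw [zpow_neg, ← inv_zpow]; rfl
  rw [loopValue, h2, h3]
  unfold colV colVinv columnVar
  split_ifs
  · simp only [Units.val_pow_eq_pow_val]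
  · simp only [Units.val_pow_eq_pow_val, inv_inv]
    ring

/-- The determinant of the activity matrix in standard form, as determined by the sums `Y` over
the ways to cut a column. -/
theorem mul_standardMatrix_det (Y : Fin k → LaurentPolynomial ℤ)
    (hY : ∀ i, loopValue * Y i = (-(colVinv n i ^ 3)) ^ (n i).natAbs - colV n i ^ (n i).natAbs) :
    loopValue * (standardMatrix n hn).det =
      ∏ i, (Y i + loopValue * colV n i ^ (n i).natAbs) + (loopValue ^ 2 - 1) * ∏ i, Y i := by
  have hne := loopValue_ne_zero
  have hpos : ∀ i, 0 < (n i).natAbs := fun i => Int.natAbs_pos.2 (hn i)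
  have hsouth : ∀ i, southWeight n i ≠ 0 := by
    intro i h
    have h1 : (colV n i) ≠ 0 := fun h => by simpa [h] using colV_mul_colVinv n i
    have h2 : (colVinv n i) ≠ 0 := fun h => by simpa [h] using colV_mul_colVinv n i
    unfold southWeight at h
    split_ifs at h
    · exact pow_ne_zero 3 h2 (neg_eq_zero.1 h)
    · exact h1 h
  -- With `v = colV n i`, the identity `δ * v⁻¹ = -v⁻³ - v` makes `δ * v⁻¹` the difference of the
  -- two ratios up to sign. The first column swaps southern and northern weights, which the
  -- geometric sum does not notice.
  have hgeom : ∀ i, colVinv n i * ∑ j : Fin (n i).natAbs, southWeight n i ^ j.1 *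
      northWeight n i ^ ((n i).natAbs - 1 - j.1) = Y i := by
    intro i
    refine mul_left_cancel₀ hne ?_
    rw [hY i, Fin.sum_univ_eq_sum_range
      (fun j => southWeight n i ^ j * northWeight n i ^ ((n i).natAbs - 1 - j))]
    have hg := (Commute.all (southWeight n i) (northWeight n i)).geom_sum₂_mul (n i).natAbs
    have hv := colV_mul_colVinv n i
    rw [loopValue_eq n i]
    unfold southWeight northWeight at hg ⊢
    split_ifs at hg ⊢
    · generalize (Finset.sum (Finset.range (n i).natAbs) _ : LaurentPolynomial ℤ) = S at hg ⊢
      linear_combination hg - colV n i * S * hv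
    · generalize (Finset.sum (Finset.range (n i).natAbs) _ : LaurentPolynomial ℤ) = S at hg ⊢
      linear_combination - hg - colV n i * S * hv
  rw [det_eq_det_of_bidiagonal_blocks hpos (southWeight n) (northWeight n) hsouth
    (standardMatrix n hn) (fun i j i' j' h => standardMatrix_inner n hn i j i' j' h)]
  have hmat : (Matrix.of fun i i' : Fin k => ∑ j : Fin (n i).natAbs, southWeight n i ^ j.1 *
      northWeight n i ^ ((n i).natAbs - 1 - j.1) *
      standardMatrix n hn ⟨i, j⟩ ⟨i', (n i').natAbs - 1, Nat.sub_lt (hpos i') one_pos⟩) =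
      borderedBidiagonal (fun i => southWeight n i ^ (n i).natAbs) Y
        (fun i => Y i + loopValue * colV n i ^ (n i).natAbs) := by
    refine Matrix.ext fun i i' => ?_
    simp only [borderedBidiagonal, Matrix.of_apply, standardMatrix_bottom]
    have hlast : ∀ j : Fin (n i).natAbs, ¬ j.1 + 1 < (n i).natAbs ↔
        j = ⟨(n i).natAbs - 1, Nat.sub_lt (hpos i) one_pos⟩ := by
      intro j
      rw [Fin.ext_iff]
      have := j.2
      simp only
      omega
    split_ifs with h0 h1 h2
    · rw [Finset.sum_eq_single ⟨(n i).natAbs - 1, Nat.sub_lt (hpos i) one_pos⟩]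
      · rw [if_neg ((hlast _).2 rfl)]
        simp only [Nat.sub_self, pow_zero, mul_one]
        rw [pow_sub_one_mul (hpos i).ne']
      · intro j _ hj
        rw [if_pos (not_not.1 (mt (hlast j).1 hj)), mul_zero]
      · simp
    · rw [← Finset.sum_mul, mul_comm, hgeom]
    -- The live weight `-v³` equals `v⁻¹ + δ * v`. The common part `v⁻¹` sums to `Y i`, and only the
    -- excess at the live crossing remains.
    · have heast : ∀ j : Fin (n i).natAbs, eastWeight n i j.1 = colVinv n i +
          (if j = (if i = 0 then ⟨0, hpos i⟩ else
            ⟨(n i).natAbs - 1, Nat.sub_lt (hpos i) one_pos⟩) then loopValue * colV n i else 0) := by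
        intro j
        have hv := colV_mul_colVinv n i
        have hl : -(colV n i ^ 3) = colVinv n i + loopValue * colV n i := by
          rw [loopValue_eq n i]
          linear_combination colVinv n i * hv
        unfold eastWeight
        by_cases hi : i = 0
        · simp only [hi, if_true, Fin.ext_iff] at *
          split_ifs <;> simp [*]
        · simp only [hi, if_false, Fin.ext_iff]
          split_ifs <;> simp [*]
      simp only [heast, mul_neg, Finset.sum_neg_distrib, mul_add, Finset.sum_add_distrib, mul_ite,
        mul_zero, Finset.sum_ite_eq', Finset.mem_univ, if_true]
      rw [← Finset.sum_mul, mul_comm _ (colVinv n i), hgeom]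
      rw [neg_inj, add_right_inj, ← pow_sub_one_mul (hpos i).ne' (colV n i)]
      -- The live crossing has elimination multiplier `v ^ (|n_i| - 1)` in both cases: from the
      -- northern weight at the top of the first column, from the southern weight at the bottom of
      -- the others.
      by_cases hi : i = 0
      · simp only [southWeight, northWeight, if_pos hi, pow_zero, Nat.sub_zero]
        ring
      · simp only [southWeight, northWeight, if_neg hi, pow_zero, Nat.sub_self]
        ring
    · simp
  rw [hmat]
  refine mul_borderedBidiagonal_det_of_first _ _ (fun i => colV n i ^ (n i).natAbs) _ _
    (fun i => rfl) ?_ ?_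
  · simp only [hY, southWeight, if_true]
    ring
  · intro i hi
    simp only [southWeight, hi, if_false]
end

/-! ## The loops of a state -/

/-- The retraction of a cycle onto a nonempty subset that moves each point backwards to the first
point of the subset. -/
theorem Fin.exists_cyclic_retraction {k : ℕ} [NeZero k] (P : Fin k → Prop) (hP : ∃ i, P i) :
    ∃ U : Fin k → Fin k, (∀ g, P (U g)) ∧ (∀ g, P g → U g = g) ∧ (∀ g, ¬ P g → U g = U (g - 1)) ∧
      ∀ (α : Type) (φ : Fin k → α), (∀ g, ¬ P g → φ g = φ (g - 1)) → ∀ g, φ g = φ (U g) := by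
  classical
  obtain ⟨u, hu⟩ := hP
  have hex : ∀ g : Fin k, ∃ t : ℕ, P ((fun i => i - 1)^[t] g) := by
    have h : ∀ i : Fin k, ∃ t : ℕ, P ((fun i => i - 1)^[t] (u + i)) := by
      intro i
      induction i using Fin.cyclic_induction with
      | h0 => exact ⟨0, by simpa using hu⟩
      | hs i ih =>
        obtain ⟨t, ht⟩ := ih
        refine ⟨t + 1, ?_⟩
        rw [Function.iterate_succ_apply, ← add_assoc, add_sub_cancel_right]
        exact ht
    intro g
    simpa using h (g - u)
  have hstep : ∀ g, ¬ P g → Nat.find (hex g) = Nat.find (hex (g - 1)) + 1 := by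
    intro g hg
    rw [Nat.find_eq_iff]
    refine ⟨Nat.find_spec (hex (g - 1)), ?_⟩
    rintro (_ | t) ht
    · exact hg
    · exact Nat.find_min (hex (g - 1)) (Nat.lt_of_succ_lt_succ ht)
  have hU : ∀ g, ¬ P g → (fun i => i - 1)^[Nat.find (hex g)] g =
      (fun i => i - 1)^[Nat.find (hex (g - 1))] (g - 1) := by
    intro g hg
    rw [hstep g hg, Function.iterate_succ_apply]
  refine ⟨fun g => (fun i => i - 1)^[Nat.find (hex g)] g,
    fun g => Nat.find_spec (hex g), ?_, hU, ?_⟩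
  · intro g hg
    have : Nat.find (hex g) = 0 := by
      rw [Nat.find_eq_zero]
      exact hg
    simp only [this, Function.iterate_zero, id]
  · intro α φ hφ g
    generalize hm : Nat.find (hex g) = m
    induction m generalizing g with
    | zero => simp [hm]
    | succ m ih =>
      have hg : ¬ P g := fun h => by
        have : Nat.find (hex g) = 0 := by
          rw [Nat.find_eq_zero]
          exact h
        omega
      have h1 := hstep g hg
      rw [hφ g hg, ih (g - 1) (by omega)]
      simp only [hm]
      rw [Function.iterate_succ_apply]
      simp only [show Nat.find (hex (g - 1)) = m by omega]

/-! ### Cut crossings and the loops through each height of a column -/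

section
variable {k : ℕ} [NeZero k] (n : Fin k → ℤ) (hn : ∀ i, n i ≠ 0)
variable (s : PretzelCrossing n → Bool)

/-- A crossing of the pretzel diagram is cut by a state if its smoothing separates the black
corners. -/
def IsCut (x : PretzelCrossing n) : Prop := xor (s x) (decide (0 < n x.1)) = true

instance (x : PretzelCrossing n) : Decidable (IsCut n s x) :=
  inferInstanceAs (Decidable (_ = _))

/-- The number of cut crossings in a column above a given height. -/
def cutsAbove (i : Fin k) (t : ℕ) : ℕ :=
  (Finset.univ.filter fun j : Fin (n i).natAbs => j.1 < t ∧ IsCut n s ⟨i, j⟩).card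

/-- The number of cut crossings in a column. -/
def cuts (i : Fin k) : ℕ :=
  (Finset.univ.filter fun j : Fin (n i).natAbs => IsCut n s ⟨i, j⟩).card

theorem cutsAbove_zero (i : Fin k) : cutsAbove n s i 0 = 0 := by
  simp [cutsAbove]

theorem cutsAbove_natAbs (i : Fin k) : cutsAbove n s i (n i).natAbs = cuts n s i := by
  simp [cutsAbove, cuts]

theorem cutsAbove_mono (i : Fin k) : Monotone (cutsAbove n s i) := by
  intro t t' h
  refine Finset.card_le_card fun j hj => ?_
  simp only [Finset.mem_filter, Finset.mem_univ, true_and] at hj ⊢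
  exact ⟨hj.1.trans_le h, hj.2⟩

theorem cutsAbove_le_cuts (i : Fin k) (t : ℕ) : cutsAbove n s i t ≤ cuts n s i := by
  refine Finset.card_le_card fun j hj => ?_
  simp only [Finset.mem_filter, Finset.mem_univ, true_and] at hj ⊢
  exact hj.2

theorem cutsAbove_succ (i : Fin k) (t : ℕ) (ht : t < (n i).natAbs) :
    cutsAbove n s i (t + 1) = cutsAbove n s i t + if IsCut n s ⟨i, t, ht⟩ then 1 else 0 := by
  unfold cutsAbove
  split_ifs with h
  · have : (Finset.univ.filter fun j : Fin (n i).natAbs => j.1 < t + 1 ∧ IsCut n s ⟨i, j⟩) =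
        insert ⟨t, ht⟩
          (Finset.univ.filter fun j : Fin (n i).natAbs => j.1 < t ∧ IsCut n s ⟨i, j⟩) := by
      ext j
      simp only [Finset.mem_filter, Finset.mem_univ, true_and, Finset.mem_insert, Fin.ext_iff]
      constructor
      · rintro ⟨h1, h2⟩
        rcases Nat.lt_succ_iff_lt_or_eq.1 h1 with h1 | h1
        · exact Or.inr ⟨h1, h2⟩
        · exact Or.inl h1
      · rintro (h1 | h1)
        · exact ⟨by omega, by rwa [show j = ⟨t, ht⟩ from Fin.ext h1]⟩
        · exact ⟨by omega, h1.2⟩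
    rw [this, Finset.card_insert_of_notMem (by simp)]
  · rw [add_zero]
    congr 1
    ext j
    simp only [Finset.mem_filter, Finset.mem_univ, true_and]
    constructor
    · rintro ⟨h1, h2⟩
      rcases Nat.lt_succ_iff_lt_or_eq.1 h1 with h1 | h1
      · exact ⟨h1, h2⟩
      · exact absurd (by rwa [show j = ⟨t, ht⟩ from Fin.ext h1] at h2) h
    · rintro ⟨h1, h2⟩
      exact ⟨by omega, h2⟩

theorem cuts_pos_of_isCut {x : PretzelCrossing n} (h : IsCut n s x) : 0 < cuts n s x.1 :=
  Finset.card_pos.2 ⟨x.2, by simpa using h⟩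

theorem exists_cutsAbove_eq (i : Fin k) (l : ℕ) (hl : l ≤ cuts n s i) :
    ∃ t ≤ (n i).natAbs, cutsAbove n s i t = l := by
  have : ∀ t ≤ (n i).natAbs, l ≤ cutsAbove n s i t → ∃ t' ≤ (n i).natAbs,
      cutsAbove n s i t' = l := by
    intro t
    induction t with
    | zero =>
      intro _ h
      rw [cutsAbove_zero] at h
      exact ⟨0, Nat.zero_le _, by rw [cutsAbove_zero]; omega⟩
    | succ t ih =>
      intro ht h
      by_cases h' : l ≤ cutsAbove n s i t
      · exact ih (by omega) h'
      · refine ⟨t + 1, ht, ?_⟩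
        rw [cutsAbove_succ n s i t ht] at h ⊢
        split_ifs at h ⊢ <;> omega
  exact this _ le_rfl (by rwa [cutsAbove_natAbs])

/-- The height of a dart in its column: a dart at height `t` lies below `t` crossings. -/
def dartHeight (d : PretzelCrossing n × Fin 4) : ℕ :=
  if d.2 = 0 ∨ d.2 = 1 then d.1.2.1 else d.1.2.1 + 1

/-- Whether a dart points to the right. -/
def dartRight (p : Fin 4) : Bool := decide (p = 0 ∨ p = 3)

/-- A dart at a given height on a given side of a column. -/
def heightDart (i : Fin k) (t : ℕ) (ht : t ≤ (n i).natAbs) (r : Bool) :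
    PretzelCrossing n × Fin 4 :=
  if h : t = 0 then (pretzelTop n hn i, if r then 0 else 1)
  else (⟨i, t - 1, by omega⟩, if r then 3 else 2)

/-- The loop through the darts at a given height on a given side of a column. -/
def heightLoop (i : Fin k) (t : ℕ) (ht : t ≤ (n i).natAbs) (r : Bool) :
    Quot ((pretzelDiagram n hn).LoopStep s) :=
  Quot.mk _ (heightDart n hn i t ht r)

theorem loop_nbr {d d' : PretzelCrossing n × Fin 4} (h : (pretzelDiagram n hn).nbr d = d') :
    Quot.mk ((pretzelDiagram n hn).LoopStep s) d = Quot.mk _ d' :=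
  Quot.sound (Or.inl h.symm)

theorem dartHeight_le (d : PretzelCrossing n × Fin 4) : dartHeight n d ≤ (n d.1.1).natAbs := by
  unfold dartHeight
  have := d.1.2.2
  split_ifs <;> omega

theorem loop_eq_heightLoop (d : PretzelCrossing n × Fin 4) :
    Quot.mk ((pretzelDiagram n hn).LoopStep s) d =
      heightLoop n hn s d.1.1 (dartHeight n d) (dartHeight_le n d) (dartRight d.2) := by
  obtain ⟨⟨i, j⟩, p⟩ := d
  match p with
  | 0 =>
    obtain ⟨_ | j, hj⟩ := j
    · rfl
    · exact (loop_nbr n hn s (pretzel_nbr_right n hn i j hj)).symm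
  | 1 =>
    obtain ⟨_ | j, hj⟩ := j
    · rfl
    · exact (loop_nbr n hn s (pretzel_nbr_left n hn i j hj)).symm
  | 2 => rfl
  | 3 => rfl

theorem heightDart_spec (i : Fin k) (t : ℕ) (ht : t ≤ (n i).natAbs) (r : Bool) :
    (heightDart n hn i t ht r).1.1 = i ∧ dartHeight n (heightDart n hn i t ht r) = t ∧
      dartRight (heightDart n hn i t ht r).2 = r := by
  obtain _ | t := t
  · cases r <;> exact ⟨rfl, rfl, rfl⟩
  · cases r <;> exact ⟨rfl, rfl, rfl⟩

theorem pretzel_smooth_of_isCut {x : PretzelCrossing n} (h : IsCut n s x) (p : Fin 4) :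
    (pretzelDiagram n hn).smooth x (s x) p = LinkDiagram.smoothPos true p := by
  unfold LinkDiagram.smooth
  exact congrArg (fun b => LinkDiagram.smoothPos b p) h

theorem pretzel_smooth_of_not_isCut {x : PretzelCrossing n} (h : ¬ IsCut n s x) (p : Fin 4) :
    (pretzelDiagram n hn).smooth x (s x) p = LinkDiagram.smoothPos false p := by
  unfold LinkDiagram.smooth
  exact congrArg (fun b => LinkDiagram.smoothPos b p) (Bool.not_eq_true _ ▸ h)

theorem loop_smooth (x : PretzelCrossing n) (p : Fin 4) :
    Quot.mk ((pretzelDiagram n hn).LoopStep s) (x, p) =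
      Quot.mk _ (x, (pretzelDiagram n hn).smooth x (s x) p) :=
  Quot.sound (Or.inr rfl)

theorem heightLoop_succ (i : Fin k) (t : ℕ) (ht : t < (n i).natAbs)
    (h : ¬ IsCut n s ⟨i, t, ht⟩) (r : Bool) :
    heightLoop n hn s i t ht.le r = heightLoop n hn s i (t + 1) ht r := by
  cases r
  · have := loop_smooth n hn s ⟨i, t, ht⟩ 1
    rw [pretzel_smooth_of_not_isCut n hn s h, loop_eq_heightLoop, loop_eq_heightLoop] at this
    exact this
  · have := loop_smooth n hn s ⟨i, t, ht⟩ 0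
    rw [pretzel_smooth_of_not_isCut n hn s h, loop_eq_heightLoop, loop_eq_heightLoop] at this
    exact this

theorem heightLoop_cut_above (i : Fin k) (t : ℕ) (ht : t < (n i).natAbs)
    (h : IsCut n s ⟨i, t, ht⟩) :
    heightLoop n hn s i t ht.le true = heightLoop n hn s i t ht.le false := by
  have := loop_smooth n hn s ⟨i, t, ht⟩ 0
  rw [pretzel_smooth_of_isCut n hn s h, loop_eq_heightLoop, loop_eq_heightLoop] at this
  exact this

theorem heightLoop_cut_below (i : Fin k) (t : ℕ) (ht : t < (n i).natAbs)
    (h : IsCut n s ⟨i, t, ht⟩) :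
    heightLoop n hn s i (t + 1) ht true = heightLoop n hn s i (t + 1) ht false := by
  have := loop_smooth n hn s ⟨i, t, ht⟩ 3
  rw [pretzel_smooth_of_isCut n hn s h, loop_eq_heightLoop, loop_eq_heightLoop] at this
  exact this

theorem heightLoop_top (i : Fin k) : heightLoop n hn s i 0 (Nat.zero_le _) true =
    heightLoop n hn s (i + 1) 0 (Nat.zero_le _) false :=
  loop_nbr n hn s (pretzel_nbr_top n hn i)

theorem heightLoop_bottom (i : Fin k) : heightLoop n hn s i _ le_rfl true =
    heightLoop n hn s (i + 1) _ le_rfl false := by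
  have h : ∀ (i : Fin k) (r : Bool), heightLoop n hn s i _ le_rfl r =
      Quot.mk _ (pretzelBottom n hn i, if r then 3 else 2) := by
    intro i r
    unfold heightLoop heightDart
    rw [dif_neg (Int.natAbs_ne_zero.2 (hn i))]
    rfl
  rw [h, h]
  exact loop_nbr n hn s (pretzel_nbr_bottom n hn i)

theorem heightLoop_eq_of_le (i : Fin k) (r : Bool) (t t' : ℕ) (ht' : t' ≤ (n i).natAbs)
    (h : t ≤ t') (hc : cutsAbove n s i t = cutsAbove n s i t') :
    heightLoop n hn s i t (h.trans ht') r = heightLoop n hn s i t' ht' r := by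
  induction t', h using Nat.le_induction with
  | base => rfl
  | succ t' h ih =>
    have h1 := cutsAbove_succ n s i t' ht'
    have h2 := cutsAbove_mono n s i h
    have h3 : ¬ IsCut n s ⟨i, t', ht'⟩ := fun h3 => by
      rw [if_pos h3] at h1
      omega
    rw [ih (by omega) (by rw [if_neg h3] at h1; omega)]
    exact heightLoop_succ n hn s i t' ht' h3 r

theorem heightLoop_eq_of_cutsAbove_eq (i : Fin k) (r : Bool) (t t' : ℕ) (ht : t ≤ (n i).natAbs)
    (ht' : t' ≤ (n i).natAbs) (hc : cutsAbove n s i t = cutsAbove n s i t') :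
    heightLoop n hn s i t ht r = heightLoop n hn s i t' ht' r := by
  rcases le_total t t' with h | h
  · exact heightLoop_eq_of_le n hn s i r t t' ht' h hc
  · exact (heightLoop_eq_of_le n hn s i r t' t ht h hc.symm).symm

/-- The nearest cut above joins the two sides of the column from below it; no crossing in between is
cut. -/
theorem heightLoop_side_of_pos (i : Fin k) (t : ℕ) (ht : t ≤ (n i).natAbs)
    (h : 0 < cutsAbove n s i t) :
    heightLoop n hn s i t ht true = heightLoop n hn s i t ht false := by
  induction t with
  | zero => simp [cutsAbove_zero] at h
  | succ t ih =>
    by_cases hc : IsCut n s ⟨i, t, ht⟩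
    · exact heightLoop_cut_below n hn s i t ht hc
    · rw [cutsAbove_succ n s i t ht, if_neg hc] at h
      rw [← heightLoop_succ n hn s i t ht hc, ← heightLoop_succ n hn s i t ht hc]
      exact ih _ h

theorem heightLoop_side_of_lt (i : Fin k) (t : ℕ) (ht : t ≤ (n i).natAbs)
    (h : cutsAbove n s i t < cuts n s i) :
    heightLoop n hn s i t ht true = heightLoop n hn s i t ht false := by
  generalize hr : (n i).natAbs - t = r
  induction r generalizing t with
  | zero =>
    obtain rfl : t = (n i).natAbs := by omega
    rw [cutsAbove_natAbs] at h
    exact absurd h (lt_irrefl _)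
  | succ r ih =>
    have ht' : t < (n i).natAbs := by omega
    by_cases hc : IsCut n s ⟨i, t, ht'⟩
    · exact heightLoop_cut_above n hn s i t ht' hc
    · have h1 := cutsAbove_succ n s i t ht'
      rw [if_neg hc] at h1
      rw [heightLoop_succ n hn s i t ht' hc, heightLoop_succ n hn s i t ht' hc]
      exact ih _ _ (by omega) (by omega)

theorem heightLoop_side (i : Fin k) (h : cuts n s i ≠ 0) (t : ℕ) (ht : t ≤ (n i).natAbs)
    (r r' : Bool) : heightLoop n hn s i t ht r = heightLoop n hn s i t ht r' := by
  have : heightLoop n hn s i t ht true = heightLoop n hn s i t ht false := by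
    rcases Nat.eq_zero_or_pos (cutsAbove n s i t) with h0 | h0
    · exact heightLoop_side_of_lt n hn s i t ht (by omega)
    · exact heightLoop_side_of_pos n hn s i t ht h0
  cases r <;> cases r' <;> simp [this]

/-- A function of the heights in the columns that separates the loops counts them. -/
theorem card_loops_eq {T : Type} (F : Fin k → ℕ → Bool → T)
    (hsucc : ∀ i t, ∀ ht : t < (n i).natAbs, ¬ IsCut n s ⟨i, t, ht⟩ →
      ∀ r, F i t r = F i (t + 1) r)
    (hcut : ∀ i t, cuts n s i ≠ 0 → F i t true = F i t false)
    (htop : ∀ i, F i 0 true = F (i + 1) 0 false)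
    (hbot : ∀ i, F i (n i).natAbs true = F (i + 1) (n (i + 1)).natAbs false)
    (hinj : ∀ i t ht r i' t' ht' r', F i t r = F i' t' r' →
      heightLoop n hn s i t ht r = heightLoop n hn s i' t' ht' r')
    (hsurj : ∀ τ, ∃ i t r, t ≤ (n i).natAbs ∧ F i t r = τ) :
    (pretzelDiagram n hn).loops s = Nat.card T := by
  let f : PretzelCrossing n × Fin 4 → T := fun d => F d.1.1 (dartHeight n d) (dartRight d.2)
  have hf : ∀ d d', (pretzelDiagram n hn).LoopStep s d d' → f d = f d' := by
    rintro d d' (rfl | rfl)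
    · refine pretzel_edge_cases n hn (P := fun d d' => f d = f d') (fun _ _ h => h.symm)
        ?_ ?_ ?_ ?_ d
      · exact fun i => htop i
      · intro i
        have e : ∀ i, (n i).natAbs - 1 + 1 = (n i).natAbs := fun i =>
          Nat.sub_add_cancel (Int.natAbs_pos.2 (hn i))
        have := hbot i
        rw [← e i, ← e (i + 1)] at this
        exact this
      · exact fun i j h => rfl
      · exact fun i j h => rfl
    · obtain ⟨x, p⟩ := d
      by_cases h : IsCut n s x
      · have hc : cuts n s x.1 ≠ 0 := (cuts_pos_of_isCut n s h).ne'
        simp only [pretzel_smooth_of_isCut n hn s h]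
        match p with
        | 0 => exact hcut x.1 _ hc
        | 1 => exact (hcut x.1 _ hc).symm
        | 2 => exact (hcut x.1 _ hc).symm
        | 3 => exact hcut x.1 _ hc
      · simp only [pretzel_smooth_of_not_isCut n hn s h]
        match p with
        | 0 => exact hsucc x.1 _ x.2.2 h _
        | 1 => exact hsucc x.1 _ x.2.2 h _
        | 2 => exact (hsucc x.1 _ x.2.2 h _).symm
        | 3 => exact (hsucc x.1 _ x.2.2 h _).symm
  refine Nat.card_congr (Equiv.ofBijective (Quot.lift f hf) ⟨?_, ?_⟩)
  · rintro ⟨d⟩ ⟨d'⟩ h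
    rw [loop_eq_heightLoop, loop_eq_heightLoop]
    exact hinj _ _ _ _ _ _ _ _ h
  · intro τ
    obtain ⟨i, t, r, ht, h⟩ := hsurj τ
    refine ⟨Quot.mk _ (heightDart n hn i t ht r), ?_⟩
    obtain ⟨h1, h2, h3⟩ := heightDart_spec n hn i t ht r
    change F _ _ _ = τ
    rw [h1, h2, h3, h]

theorem heightLoop_top_left (i : Fin k) : heightLoop n hn s i 0 (Nat.zero_le _) false =
    heightLoop n hn s (i - 1) 0 (Nat.zero_le _) true := by
  have := heightLoop_top n hn s (i - 1)
  rw [sub_add_cancel] at this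
  exact this.symm

theorem heightLoop_bottom_left (i : Fin k) : heightLoop n hn s i _ le_rfl false =
    heightLoop n hn s (i - 1) _ le_rfl true := by
  have := heightLoop_bottom n hn s (i - 1)
  rw [sub_add_cancel] at this
  exact this.symm

/-- Apart from the loops trapped between successive cuts, each loop runs along the right side of
exactly one uncut column and is named by that column. -/
theorem loops_of_exists_uncut (h : ∃ i, cuts n s i = 0) :
    (pretzelDiagram n hn).loops s =
      ∑ i, (cuts n s i - 1) + (Finset.univ.filter fun i => cuts n s i = 0).card := by
  -- `U` finds the nearest uncut column at or to the left of a given one; a left side at column `i`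
  -- is treated as the right side at column `i - 1`.
  obtain ⟨U, hU0, hU1, hU2, hU3⟩ := Fin.exists_cyclic_retraction (fun i => cuts n s i = 0) h
  let F : Fin k → ℕ → Bool → (Σ i, Fin (cuts n s i - 1)) ⊕ {i // cuts n s i = 0} := fun i t r =>
    if h : 0 < cutsAbove n s i t ∧ cutsAbove n s i t < cuts n s i then
      .inl ⟨i, cutsAbove n s i t - 1, by omega⟩
    else .inr ⟨U (if r then i else i - 1), hU0 _⟩
  have hFin : ∀ i t r, ∀ h : 0 < cutsAbove n s i t ∧ cutsAbove n s i t < cuts n s i,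
      F i t r = .inl ⟨i, cutsAbove n s i t - 1, by omega⟩ := fun i t r h => dif_pos h
  have hFout : ∀ i t r, ¬ (0 < cutsAbove n s i t ∧ cutsAbove n s i t < cuts n s i) →
      F i t r = .inr ⟨U (if r then i else i - 1), hU0 _⟩ := fun i t r h => dif_neg h
  have htop := hU3 _ (fun i => heightLoop n hn s i 0 (Nat.zero_le _) true) fun i hi => by
    rw [heightLoop_side n hn s i hi 0 _ true false, heightLoop_top_left]
  have hbot := hU3 _ (fun i => heightLoop n hn s i _ le_rfl true) fun i hi => by
    rw [heightLoop_side n hn s i hi _ _ true false, heightLoop_bottom_left]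
  have hout : ∀ i t ht r, ¬ (0 < cutsAbove n s i t ∧ cutsAbove n s i t < cuts n s i) →
      heightLoop n hn s i t ht r =
        heightLoop n hn s (U (if r then i else i - 1)) 0 (Nat.zero_le _) true := by
    intro i t ht r hno
    have hle := cutsAbove_le_cuts n s i t
    rcases Nat.eq_zero_or_pos (cutsAbove n s i t) with h0 | h0
    · rw [heightLoop_eq_of_cutsAbove_eq n hn s i r t 0 ht (Nat.zero_le _)
        (by rw [h0, cutsAbove_zero])]
      cases r
      · rw [heightLoop_top_left]
        exact htop _
      · exact htop _
    · rw [heightLoop_eq_of_cutsAbove_eq n hn s i r t _ ht le_rfl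
        (by rw [cutsAbove_natAbs]; omega)]
      -- An uncut column connects the top and the bottom on its right side, so both ends name the
      -- same loop.
      have hu : ∀ u, cuts n s u = 0 → heightLoop n hn s u 0 (Nat.zero_le _) true =
          heightLoop n hn s u _ le_rfl true := fun u hu =>
        heightLoop_eq_of_cutsAbove_eq n hn s u true _ _ _ _
          (by rw [cutsAbove_natAbs, cutsAbove_zero, hu])
      rw [hu _ (hU0 _)]
      cases r
      · rw [heightLoop_bottom_left]
        exact hbot _
      · exact hbot _
  rw [card_loops_eq n hn s F]
  · rw [Nat.card_sum, Nat.card_sigma, Nat.card_eq_fintype_card, Fintype.card_subtype]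
    simp
  · intro i t ht hc r
    have h1 := cutsAbove_succ n s i t ht
    rw [if_neg hc, add_zero] at h1
    simp only [F, h1]
  · intro i t hi
    by_cases hin : 0 < cutsAbove n s i t ∧ cutsAbove n s i t < cuts n s i
    · rw [hFin _ _ _ hin, hFin _ _ _ hin]
    · rw [hFout _ _ _ hin, hFout _ _ _ hin]
      simp [hU2 i hi]
  · intro i
    rw [hFout _ _ _ (by simp [cutsAbove_zero]), hFout _ _ _ (by simp [cutsAbove_zero])]
    simp
  · intro i
    rw [hFout _ _ _ (by simp [cutsAbove_natAbs]), hFout _ _ _ (by simp [cutsAbove_natAbs])]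
    simp
  · intro i t ht r i' t' ht' r' hF
    by_cases hin : 0 < cutsAbove n s i t ∧ cutsAbove n s i t < cuts n s i <;>
      by_cases hin' : 0 < cutsAbove n s i' t' ∧ cutsAbove n s i' t' < cuts n s i'
    · rw [hFin _ _ _ hin, hFin _ _ _ hin', Sum.inl.injEq] at hF
      obtain rfl : i = i' := congrArg Sigma.fst hF
      have hv := congrArg Fin.val (eq_of_heq (Sigma.mk.inj hF).2)
      simp only at hv
      rw [heightLoop_side n hn s i (by omega) t ht r r']
      exact heightLoop_eq_of_cutsAbove_eq n hn s i r' t t' ht ht' (by omega)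
    · rw [hFin _ _ _ hin, hFout _ _ _ hin'] at hF
      cases hF
    · rw [hFout _ _ _ hin, hFin _ _ _ hin'] at hF
      cases hF
    · rw [hFout _ _ _ hin, hFout _ _ _ hin', Sum.inr.injEq, Subtype.mk.injEq] at hF
      rw [hout _ _ _ _ hin, hout _ _ _ _ hin', hF]
  · rintro (⟨i, l, hl⟩ | ⟨i, hi⟩)
    · obtain ⟨t, ht, hc⟩ := exists_cutsAbove_eq n s i (l + 1) (by omega)
      refine ⟨i, t, true, ht, ?_⟩
      rw [hFin _ _ _ (by omega)]
      simp [hc]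
    · refine ⟨i, 0, true, Nat.zero_le _, ?_⟩
      rw [hFout _ _ _ (by simp [cutsAbove_zero])]
      simp [hU1 i hi]

/-- With no uncut column, the part above all first cuts and the part below all last cuts each close
up to one loop, which gives the summand 2. -/
theorem loops_of_forall_cut (h : ∀ i, cuts n s i ≠ 0) :
    (pretzelDiagram n hn).loops s = ∑ i, (cuts n s i - 1) + 2 := by
  let F : Fin k → ℕ → Bool → (Σ i, Fin (cuts n s i - 1)) ⊕ Bool := fun i t _ =>
    if h : 0 < cutsAbove n s i t ∧ cutsAbove n s i t < cuts n s i then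
      .inl ⟨i, cutsAbove n s i t - 1, by omega⟩
    else .inr (decide (cutsAbove n s i t = 0))
  have hFin : ∀ i t r, ∀ h : 0 < cutsAbove n s i t ∧ cutsAbove n s i t < cuts n s i,
      F i t r = .inl ⟨i, cutsAbove n s i t - 1, by omega⟩ := fun i t r h => dif_pos h
  have hFout : ∀ i t r, ¬ (0 < cutsAbove n s i t ∧ cutsAbove n s i t < cuts n s i) →
      F i t r = .inr (decide (cutsAbove n s i t = 0)) := fun i t r h => dif_neg h
  have htop : ∀ i, heightLoop n hn s i 0 (Nat.zero_le _) true =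
      heightLoop n hn s 0 0 (Nat.zero_le _) true := by
    intro i
    induction i using Fin.cyclic_induction with
    | h0 => rfl
    | hs i ih =>
      rw [← ih, heightLoop_top n hn s i]
      exact heightLoop_side n hn s _ (h _) _ _ _ _
  have hbot : ∀ i, heightLoop n hn s i _ le_rfl true = heightLoop n hn s 0 _ le_rfl true := by
    intro i
    induction i using Fin.cyclic_induction with
    | h0 => rfl
    | hs i ih =>
      rw [← ih, heightLoop_bottom n hn s i]
      exact heightLoop_side n hn s _ (h _) _ _ _ _
  rw [card_loops_eq n hn s F]
  · rw [Nat.card_sum, Nat.card_sigma]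
    simp
  · intro i t ht hc r
    have h1 := cutsAbove_succ n s i t ht
    rw [if_neg hc, add_zero] at h1
    simp only [F, h1]
  · intro i t _
    rfl
  · intro i
    rw [hFout i 0 true (by simp [cutsAbove_zero]), hFout (i + 1) 0 false (by simp [cutsAbove_zero])]
    simp [cutsAbove_zero]
  · intro i
    rw [hFout i _ true (by simp [cutsAbove_natAbs]),
      hFout (i + 1) _ false (by simp [cutsAbove_natAbs])]
    simp [cutsAbove_natAbs, h]
  · intro i t ht r i' t' ht' r' hF
    have hle := cutsAbove_le_cuts n s i t
    have hle' := cutsAbove_le_cuts n s i' t'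
    by_cases hin : 0 < cutsAbove n s i t ∧ cutsAbove n s i t < cuts n s i <;>
      by_cases hin' : 0 < cutsAbove n s i' t' ∧ cutsAbove n s i' t' < cuts n s i'
    · rw [hFin i t r hin, hFin i' t' r' hin', Sum.inl.injEq] at hF
      obtain rfl : i = i' := congrArg Sigma.fst hF
      have hv := congrArg Fin.val (eq_of_heq (Sigma.mk.inj hF).2)
      simp only at hv
      rw [heightLoop_side n hn s i (by omega) t ht r r']
      exact heightLoop_eq_of_cutsAbove_eq n hn s i r' t t' ht ht' (by omega)
    · rw [hFin i t r hin, hFout i' t' r' hin'] at hF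
      cases hF
    · rw [hFout i t r hin, hFin i' t' r' hin'] at hF
      cases hF
    · rw [hFout i t r hin, hFout i' t' r' hin', Sum.inr.injEq, decide_eq_decide] at hF
      rw [heightLoop_side n hn s i (h i) t ht r true,
        heightLoop_side n hn s i' (h i') t' ht' r' true]
      by_cases h0 : cutsAbove n s i t = 0
      · rw [heightLoop_eq_of_cutsAbove_eq n hn s i true t 0 ht (Nat.zero_le _)
          (by rw [h0, cutsAbove_zero]),
          heightLoop_eq_of_cutsAbove_eq n hn s i' true t' 0 ht' (Nat.zero_le _)
          (by rw [hF.1 h0, cutsAbove_zero]), htop, htop i']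
      · have h0' := mt hF.2 h0
        rw [heightLoop_eq_of_cutsAbove_eq n hn s i true t _ ht le_rfl
          (by rw [cutsAbove_natAbs]; omega),
          heightLoop_eq_of_cutsAbove_eq n hn s i' true t' _ ht' le_rfl
          (by rw [cutsAbove_natAbs]; omega), hbot, hbot i']
  · rintro (⟨i, l, hl⟩ | _ | _)
    · obtain ⟨t, ht, hc⟩ := exists_cutsAbove_eq n s i (l + 1) (by omega)
      refine ⟨i, t, true, ht, ?_⟩
      rw [hFin i t true (by omega)]
      simp [hc]
    · refine ⟨0, _, true, le_rfl, ?_⟩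
      rw [hFout 0 _ true (by simp [cutsAbove_natAbs])]
      simp [cutsAbove_natAbs, h]
    · refine ⟨0, 0, true, Nat.zero_le _, ?_⟩
      rw [hFout 0 0 true (by simp [cutsAbove_zero])]
      simp [cutsAbove_zero]

end

/-! ## The Kauffman bracket of the pretzel diagram -/

section
variable {R : Type*} [CommRing R] (δ v w : R)

/-- The weight of a choice of smoothings in a column. -/
def columnStateWeight {m : ℕ} (c : Fin m → Bool) : R := ∏ j, if c j then w else v

/-- The number of cut crossings in a choice of smoothings in a column. -/
def cutCount {m : ℕ} (c : Fin m → Bool) : ℕ := (Finset.univ.filter fun j => c j = true).card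

/-- The factor of the loops inside a cut column. -/
def cutFactor (c : ℕ) : R := if c = 0 then 0 else δ ^ (c - 1)

theorem cutCount_eq_zero_iff {m : ℕ} (c : Fin m → Bool) :
    cutCount c = 0 ↔ c = fun _ => false := by
  simp [cutCount, Finset.filter_eq_empty_iff, funext_iff]

theorem sum_columnStateWeight_ite {m : ℕ} (a : R) :
    ∑ c : Fin m → Bool, columnStateWeight v w c * (if cutCount c = 0 then a else 0) =
      a * v ^ m := by
  simp only [cutCount_eq_zero_iff, mul_ite, mul_zero, Finset.sum_ite_eq', Finset.mem_univ, if_true]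
  simp [columnStateWeight, mul_comm]

theorem sum_columnStateWeight_pow {m : ℕ} :
    ∑ c : Fin m → Bool, columnStateWeight v w c * δ ^ cutCount c = (v + w * δ) ^ m := by
  have h : ∀ c : Fin m → Bool, columnStateWeight v w c * δ ^ cutCount c =
      ∏ j, if c j then w * δ else v := by
    intro c
    have : δ ^ cutCount c = ∏ j, if c j then δ else 1 := by
      rw [Finset.prod_ite, cutCount]
      simp
    rw [this, columnStateWeight, ← Finset.prod_mul_distrib]
    refine Finset.prod_congr rfl fun j _ => ?_
    split_ifs <;> simp
  simp only [h]
  have := Finset.prod_univ_sum (fun _ : Fin m => (Finset.univ : Finset Bool))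
    (fun _ b => if b = true then w * δ else v)
  rw [Fintype.piFinset_univ] at this
  rw [← this]
  simp [add_comm]

/-- The sum over the choices of smoothings that cut a column. -/
def cutSum (m : ℕ) : R := ∑ c : Fin m → Bool, columnStateWeight v w c * cutFactor δ (cutCount c)

/-- Summing `δ ^ cutCount` over all choices gives a binomial power; the choice without cuts
contributes `v ^ m` and is removed. -/
theorem mul_cutSum (m : ℕ) : δ * cutSum δ v w m = (v + w * δ) ^ m - v ^ m := by
  rw [← sum_columnStateWeight_pow, ← one_mul (v ^ m), ← sum_columnStateWeight_ite v w,
    ← Finset.sum_sub_distrib, cutSum, Finset.mul_sum]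
  refine Finset.sum_congr rfl fun c _ => ?_
  unfold cutFactor
  split_ifs with h
  · simp [h]
  · rw [mul_left_comm, mul_pow_sub_one h]
    simp

theorem sum_columnStateWeight_cutFactor_add (m : ℕ) :
    ∑ c : Fin m → Bool, columnStateWeight v w c *
      (cutFactor δ (cutCount c) + if cutCount c = 0 then δ else 0) =
      cutSum δ v w m + δ * v ^ m := by
  simp only [mul_add, Finset.sum_add_distrib, sum_columnStateWeight_ite]
  rfl

end

/-! ### The state sum over all columns -/

section
variable {k : ℕ} [NeZero k] (n : Fin k → ℤ) (hn : ∀ i, n i ≠ 0)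

theorem loops_pos (s : PretzelCrossing n → Bool) : (pretzelDiagram n hn).loops s ≠ 0 := by
  by_cases h : ∃ i, cuts n s i = 0
  · rw [loops_of_exists_uncut n hn s h]
    have : 0 < (Finset.univ.filter fun i => cuts n s i = 0).card := by
      obtain ⟨i, hi⟩ := h
      exact Finset.card_pos.2 ⟨i, by simpa using hi⟩
    omega
  · push Not at h
    rw [loops_of_forall_cut n hn s h]
    omega

/-- If some column is uncut, the second product vanishes and the first counts the loops. If all are
cut, both products agree and the coefficients add to `δ²`, for the two outer loops. -/
theorem pow_loops {R : Type*} [CommRing R] (δ : R) (s : PretzelCrossing n → Bool) :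
    δ ^ (pretzelDiagram n hn).loops s =
      ∏ i, (cutFactor δ (cuts n s i) + if cuts n s i = 0 then δ else 0) +
        (δ ^ 2 - 1) * ∏ i, cutFactor δ (cuts n s i) := by
  by_cases h : ∃ i, cuts n s i = 0
  · have h0 : ∏ i, cutFactor δ (cuts n s i) = 0 := by
      obtain ⟨i, hi⟩ := h
      exact Finset.prod_eq_zero (Finset.mem_univ i) (by simp [cutFactor, hi])
    -- For an uncut column the truncated exponent `0 - 1` is 0, leaving just the factor `δ`.
    have h1 : ∀ i, cutFactor δ (cuts n s i) + (if cuts n s i = 0 then δ else 0) =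
        δ ^ (cuts n s i - 1) * if cuts n s i = 0 then δ else 1 := by
      intro i
      unfold cutFactor
      split_ifs with hi <;> simp [hi]
    rw [h0, loops_of_exists_uncut n hn s h]
    simp only [h1]
    rw [Finset.prod_mul_distrib, Finset.prod_pow_eq_pow_sum, Finset.prod_ite, pow_add]
    simp
  · push Not at h
    rw [loops_of_forall_cut n hn s h]
    simp only [h, if_false, add_zero, cutFactor, Finset.prod_pow_eq_pow_sum]
    ring

/-- States of the pretzel diagram in terms of cut crossings. -/
def stateEquiv : (∀ i : Fin k, Fin (n i).natAbs → Bool) ≃ (PretzelCrossing n → Bool) where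
  toFun c x := xor (c x.1 x.2) (decide (0 < n x.1))
  invFun s i j := xor (s ⟨i, j⟩) (decide (0 < n i))
  left_inv c := by
    funext i j
    simp
  right_inv s := by
    funext x
    simp

theorem cuts_stateEquiv (c : ∀ i : Fin k, Fin (n i).natAbs → Bool) (i : Fin k) :
    cuts n (stateEquiv n c) i = cutCount (c i) := by
  simp [cuts, cutCount, IsCut, stateEquiv]

/-- A cut is a `B`-smoothing where `n_i > 0` and an `A`-smoothing where `n_i < 0`, so its weight is
the inverse of the column variable in both cases. -/
theorem prod_stateEquiv (c : ∀ i : Fin k, Fin (n i).natAbs → Bool) :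
    ((∏ x, if stateEquiv n c x then LinkDiagram.varA else LinkDiagram.varA⁻¹ :
      (LaurentPolynomial ℤ)ˣ) : LaurentPolynomial ℤ) =
      ∏ i, columnStateWeight (colV n i) (colVinv n i) (c i) := by
  rw [Units.coe_prod, Fintype.prod_sigma]
  refine Finset.prod_congr rfl fun i _ => Finset.prod_congr rfl fun j _ => ?_
  simp only [stateEquiv, Equiv.coe_fn_mk, colV, colVinv, columnVar]
  by_cases h : 0 < n i <;> by_cases hc : c i j = true <;> simp [h, hc]

/-- The factor `loopValue` turns the exponent `loops - 1` into `loops`, as there is always a loop.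
By `pow_loops` each state then contributes two products over the columns, and the sum distributes.
-/
theorem mul_bracket : loopValue * (pretzelDiagram n hn).bracket =
    ∏ i, (cutSum loopValue (colV n i) (colVinv n i) (n i).natAbs +
        loopValue * colV n i ^ (n i).natAbs) +
      (loopValue ^ 2 - 1) * ∏ i, cutSum loopValue (colV n i) (colVinv n i) (n i).natAbs := by
  have hdef : (pretzelDiagram n hn).bracket = ∑ s : PretzelCrossing n → Bool,
      ((∏ x, if s x then LinkDiagram.varA else LinkDiagram.varA⁻¹ : (LaurentPolynomial ℤ)ˣ) :
        LaurentPolynomial ℤ) * loopValue ^ ((pretzelDiagram n hn).loops s - 1) := rfl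
  have hprod : ∀ f : ∀ i : Fin k, (Fin (n i).natAbs → Bool) → LaurentPolynomial ℤ,
      ∏ i, ∑ c, f i c = ∑ c : ∀ i : Fin k, Fin (n i).natAbs → Bool, ∏ i, f i (c i) := by
    intro f
    rw [Finset.prod_univ_sum, Fintype.piFinset_univ]
  simp only [← sum_columnStateWeight_cutFactor_add]
  simp only [cutSum]
  rw [hprod, hprod, hdef, Finset.mul_sum, Finset.mul_sum, ← Finset.sum_add_distrib,
    ← (stateEquiv n).sum_comp]
  refine Finset.sum_congr rfl fun c _ => ?_
  rw [prod_stateEquiv, mul_left_comm, mul_pow_sub_one (loops_pos n hn _), pow_loops]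
  simp only [cuts_stateEquiv, Finset.prod_mul_distrib]
  ring

theorem standardMatrix_det : (standardMatrix n hn).det = (pretzelDiagram n hn).bracket := by
  refine mul_left_cancel₀ loopValue_ne_zero ?_
  rw [mul_bracket]
  refine mul_standardMatrix_det n hn _ fun i => ?_
  rw [mul_cutSum]
  congr 2
  -- What remains is `v + v⁻¹ * δ = -v⁻³`, which matches the binomial base with the live black
  -- weight.
  rw [loopValue_eq n i]
  linear_combination - colV n i * colV_mul_colVinv n i

end

end

theorem theorem4p2 (k : ℕ) [NeZero k] (n : Fin k → ℤ) (hn : ∀ i, n i ≠ 0)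
    (hK : (pretzelDiagram n hn).IsKnot) (o : (pretzelDiagram n hn).Orientation) :
    Nonempty (PretzelCrossing n ≃
      {f : (pretzelDiagram n hn).Face // f ≠ upperDeck n hn ∧ f ≠ universalFace n hn}) ∧
    ∀ e : PretzelCrossing n ≃
        {f : (pretzelDiagram n hn).Face // f ≠ upperDeck n hn ∧ f ≠ universalFace n hn},
      ((o.activityMatrix (pretzelLabel n) (upperDeck n hn) (universalFace n hn)).submatrix
          id e).det = o.jones ∨
      ((o.activityMatrix (pretzelLabel n) (upperDeck n hn) (universalFace n hn)).submatrix
          id e).det = -o.jones := by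
  refine ⟨⟨balancedFaceEquiv n hn⟩, fun e => ?_⟩
  obtain ⟨ε, hε, h⟩ := activityMatrix_det n hn o e
  rw [standardMatrix_det] at h
  rw [h, LinkDiagram.Orientation.jones]
  rcases hε with rfl | rfl
  · exact Or.inl (one_mul _)
  · exact Or.inr (neg_one_mul _)
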